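/- Let $M$ be a smooth ($C^\infty$, Hausdorff, second countable, without boundary, not necessarily connected) $n$-manifold. Let $\Omega^j(M)$ be the space of smooth real differential $j$-forms on $M$ (with $\Omega^{-1}=0$), $d$ the exterior derivative, and $B^k(M)=d\,\Omega^{k-1}(M)$. Let $\overline{Z}^k(M)$ be the space of those closed forms $\lambda\in\Omega^k(M)$ for which there are a compact set $K\subseteq M$ and $\nu\in\Omega^{k-1}(M\setminus K)$ with $d\nu=\lambda|_{M\setminus K}$, and put $$c_k(M)=\dim_{\mathbb R}\,\overline{Z}^k(M)/B^k(M).$$ Let $k$ be an integer with $0<k\neq n$, and let $B\subset M$ be an open $n$-ball with compact closure in $M$, in the sense that there are a smooth chart $\varphi$ of $M$ and a closed Euclidean ball $\overline{D}$ of positive radius contained in the image of $\varphi$ such that $B=\varphi^{-1}(D)$, where $D$ is the interior of $\overline{D}$. Then $$c_k(M\setminus\overline{B})=c_k(M),$$ as an equality of (possibly infinite) cardinal numbers, where $M\setminus\overline B$ is regarded as an open submanifold of $M$. -/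

import Mathlib

open scoped Manifold ContDiff Topology

noncomputable section

namespace DeRham

variable {n : ℕ} {M : Type*} [TopologicalSpace M] [ChartedSpace (EuclideanSpace ℝ (Fin n)) M]

/-- A (not necessarily smooth) real-valued differential `k`-form on the `n`-manifold `M`: an
alternating `k`-linear form on each tangent space. -/
def Form (n : ℕ) (M : Type*) [TopologicalSpace M]
    [ChartedSpace (EuclideanSpace ℝ (Fin n)) M] (k : ℕ) : Type _ :=
  (x : M) → TangentSpace (𝓡 n) x [⋀^Fin k]→L[ℝ] ℝ

instance (k : ℕ) : AddCommGroup (Form n M k) :=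
  inferInstanceAs (AddCommGroup ((x : M) → TangentSpace (𝓡 n) x [⋀^Fin k]→L[ℝ] ℝ))

instance (k : ℕ) : Module ℝ (Form n M k) :=
  inferInstanceAs (Module ℝ ((x : M) → TangentSpace (𝓡 n) x [⋀^Fin k]→L[ℝ] ℝ))

/-- The expression of a form in the chart `φ` of `M` around `x₀`, that is, the pullback of `α`
by `φ⁻¹`, a form on (the target of `φ` in) `ℝⁿ`. -/
def Form.inChart {k : ℕ} (α : Form n M k) (x₀ : M) (y : EuclideanSpace ℝ (Fin n)) :
    EuclideanSpace ℝ (Fin n) [⋀^Fin k]→L[ℝ] ℝ :=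
  (α ((extChartAt (𝓡 n) x₀).symm y)).compContinuousLinearMap
    (mfderiv 𝓘(ℝ, EuclideanSpace ℝ (Fin n)) (𝓡 n) (extChartAt (𝓡 n) x₀).symm y)

/-- `α` is a smooth form on the set `s` (used for open `s` only): its expression in each chart is
`C^∞`. -/
def Form.SmoothOn {k : ℕ} (α : Form n M k) (s : Set M) : Prop :=
  ∀ x₀ : M, ContDiffOn ℝ ∞ (α.inChart x₀)
    ((extChartAt (𝓡 n) x₀).target ∩ (extChartAt (𝓡 n) x₀).symm ⁻¹' s)

/-- The exterior derivative on a manifold: at `x`, with `φ` the chart around `x`, it is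
`φ^* (d ((φ⁻¹)^* α))`, where the inner `d` is the exterior derivative on `ℝⁿ`. -/
def Form.d {k : ℕ} (α : Form n M k) : Form n M (k + 1) := fun x =>
  (extDeriv (α.inChart x) (extChartAt (𝓡 n) x x)).compContinuousLinearMap
    (mfderiv (𝓡 n) 𝓘(ℝ, EuclideanSpace ℝ (Fin n)) (extChartAt (𝓡 n) x) x)

/-- `α` restricted to the set `s` (used for open `s` only) is `dν` for some smooth form `ν` on `s`
of degree one less. There are no nonzero forms of degree `-1`, so for `k = 0` this means that `α`
vanishes on `s`. Values of `ν` outside `s` play no role. -/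
def Form.ExactOn : {k : ℕ} → Form n M k → Set M → Prop
  | 0, α, s => ∀ x ∈ s, α x = 0
  | _ + 1, α, s => ∃ ν : Form n M _, ν.SmoothOn s ∧ ∀ x ∈ s, ν.d x = α x

section helpers

variable {k : ℕ}

theorem Form.zero_apply (x : M) : (0 : Form n M k) x = 0 := rfl

theorem Form.add_apply (α η : Form n M k) (x : M) : (α + η) x = α x + η x := rfl

theorem Form.smul_apply (c : ℝ) (α : Form n M k) (x : M) : (c • α) x = c • α x := rfl

theorem Form.inChart_zero (x₀ : M) : (0 : Form n M k).inChart x₀ = 0 := by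
  rfl

theorem Form.inChart_add (α η : Form n M k) (x₀ : M) :
    (α + η).inChart x₀ = α.inChart x₀ + η.inChart x₀ := by
  rfl

theorem Form.inChart_smul (c : ℝ) (α : Form n M k) (x₀ : M) :
    (c • α).inChart x₀ = c • α.inChart x₀ := by
  rfl

theorem Form.SmoothOn.mono {α : Form n M k} {s t : Set M} (h : α.SmoothOn t) (hst : s ⊆ t) :
    α.SmoothOn s := fun x₀ =>
  (h x₀).mono (Set.inter_subset_inter_right _ (Set.preimage_mono hst))

theorem Form.SmoothOn.zero (s : Set M) : (0 : Form n M k).SmoothOn s := fun x₀ => by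
  rw [Form.inChart_zero]; exact contDiffOn_const

theorem Form.SmoothOn.add {α η : Form n M k} {s : Set M} (hα : α.SmoothOn s)
    (hη : η.SmoothOn s) : (α + η).SmoothOn s := fun x₀ => by
  rw [Form.inChart_add]; exact (hα x₀).add (hη x₀)

theorem Form.SmoothOn.smul {α : Form n M k} {s : Set M} (c : ℝ) (hα : α.SmoothOn s) :
    (c • α).SmoothOn s := fun x₀ => by
  rw [Form.inChart_smul]; exact (hα x₀).const_smul c

theorem Form.SmoothOn.differentiableAt {α : Form n M k} {s : Set M} (hs : IsOpen s)
    (hα : α.SmoothOn s) {x : M} (hx : x ∈ s) :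
    DifferentiableAt ℝ (α.inChart x) (extChartAt (𝓡 n) x x) := by
  refine ((hα x).contDiffAt ?_).differentiableAt (by simp)
  refine Filter.inter_mem (extChartAt_target_mem_nhds x) ?_
  refine (continuousAt_extChartAt_symm x).preimage_mem_nhds ?_
  rw [extChartAt_to_inv]
  exact hs.mem_nhds hx

theorem Form.d_add {α η : Form n M k} {s : Set M} (hs : IsOpen s) (hα : α.SmoothOn s)
    (hη : η.SmoothOn s) {x : M} (hx : x ∈ s) : (α + η).d x = α.d x + η.d x := by
  simp only [Form.d, Form.inChart_add]
  rw [extDeriv_add (hα.differentiableAt hs hx) (hη.differentiableAt hs hx)]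
  rfl

theorem Form.d_smul (c : ℝ) (α : Form n M k) : (c • α).d = c • α.d := by
  funext x
  simp only [Form.d, Form.inChart_smul]
  rw [extDeriv_smul]
  rfl

theorem Form.d_zero : (0 : Form n M k).d = 0 := by
  have h := Form.d_smul (0 : ℝ) (0 : Form n M k)
  rwa [zero_smul, zero_smul] at h

theorem Form.ExactOn.mono {α : Form n M k} {s t : Set M} (h : α.ExactOn t) (hst : s ⊆ t) :
    α.ExactOn s := by
  cases k with
  | zero => exact fun x hx => h x (hst hx)
  | succ k => obtain ⟨ν, hν, hd⟩ := h; exact ⟨ν, hν.mono hst, fun x hx => hd x (hst hx)⟩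

theorem Form.ExactOn.zero (s : Set M) : (0 : Form n M k).ExactOn s := by
  cases k with
  | zero => exact fun _ _ => rfl
  | succ k => exact ⟨0, .zero s, fun x _ => by rw [Form.d_zero]⟩

theorem Form.ExactOn.add {α η : Form n M k} {s : Set M} (hs : IsOpen s) (hα : α.ExactOn s)
    (hη : η.ExactOn s) : (α + η).ExactOn s := by
  cases k with
  | zero => exact fun x hx => by rw [Form.add_apply, hα x hx, hη x hx, add_zero]
  | succ k =>
    obtain ⟨ν, hν, hd⟩ := hα
    obtain ⟨μ, hμ, he⟩ := hη
    exact ⟨ν + μ, hν.add hμ, fun x hx => by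
      rw [Form.d_add hs hν hμ hx, hd x hx, he x hx, Form.add_apply]⟩

theorem Form.ExactOn.smul {α : Form n M k} {s : Set M} (c : ℝ) (hα : α.ExactOn s) :
    (c • α).ExactOn s := by
  cases k with
  | zero => exact fun x hx => by rw [Form.smul_apply, hα x hx, smul_zero]
  | succ k =>
    obtain ⟨ν, hν, hd⟩ := hα
    exact ⟨c • ν, hν.smul c, fun x hx => by
      rw [Form.d_smul, Form.smul_apply, hd x hx, Form.smul_apply]⟩

end helpers

/-- `Ω^k(M)`: the smooth `k`-forms on `M`. -/
def smoothForms (n : ℕ) (M : Type*) [TopologicalSpace M]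
    [ChartedSpace (EuclideanSpace ℝ (Fin n)) M] (k : ℕ) : Submodule ℝ (Form n M k) where
  carrier := {α | α.SmoothOn Set.univ}
  zero_mem' := .zero _
  add_mem' := .add
  smul_mem' c _ h := h.smul c

/-- `Z^k(M)`: the closed smooth `k`-forms on `M`. -/
def closedForms (n : ℕ) (M : Type*) [TopologicalSpace M]
    [ChartedSpace (EuclideanSpace ℝ (Fin n)) M] (k : ℕ) : Submodule ℝ (Form n M k) where
  carrier := {α | α ∈ smoothForms n M k ∧ α.d = 0}
  zero_mem' := ⟨zero_mem _, Form.d_zero⟩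
  add_mem' {α η} h h' := ⟨add_mem h.1 h'.1, by
    funext x
    rw [Form.d_add isOpen_univ h.1 h'.1 (Set.mem_univ x), h.2, h'.2]
    exact add_zero _⟩
  smul_mem' c α h := ⟨Submodule.smul_mem _ c h.1, by rw [Form.d_smul, h.2, smul_zero]⟩

/-- `B^k(M)`: the exact `k`-forms on `M`, i.e. the image of `d : Ω^{k-1}(M) → Ω^k(M)`
(the zero space for `k = 0`). -/
def exactForms (n : ℕ) (M : Type*) [TopologicalSpace M]
    [ChartedSpace (EuclideanSpace ℝ (Fin n)) M] (k : ℕ) : Submodule ℝ (Form n M k) where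
  carrier := {α | α.ExactOn Set.univ}
  zero_mem' := .zero _
  add_mem' := .add isOpen_univ
  smul_mem' c _ h := h.smul c

/-- The closed `k`-forms on `M` that are exact outside some compact set. -/
def closedFormsExactAtInfinity (n : ℕ) (M : Type*) [TopologicalSpace M] [T2Space M]
    [ChartedSpace (EuclideanSpace ℝ (Fin n)) M] (k : ℕ) : Submodule ℝ (Form n M k) where
  carrier := {α | α ∈ closedForms n M k ∧ ∃ K : Set M, IsCompact K ∧ α.ExactOn Kᶜ}
  zero_mem' := ⟨zero_mem _, ∅, isCompact_empty, .zero _⟩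
  add_mem' := by
    rintro α η ⟨hα, K, hK, h⟩ ⟨hη, L, hL, h'⟩
    refine ⟨add_mem hα hη, K ∪ L, hK.union hL, ?_⟩
    exact (h.mono (Set.compl_subset_compl.2 Set.subset_union_left)).add
      (hK.union hL).isClosed.isOpen_compl
      (h'.mono (Set.compl_subset_compl.2 Set.subset_union_right))
  smul_mem' c α h := by
    obtain ⟨hα, K, hK, h⟩ := h
    exact ⟨Submodule.smul_mem _ c hα, K, hK, h.smul c⟩

/-- `c_k(M)`: the dimension of the space of closed `k`-forms that are exact outside a compact set,
modulo the exact forms. -/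
def c (n : ℕ) (M : Type*) [TopologicalSpace M] [T2Space M]
    [ChartedSpace (EuclideanSpace ℝ (Fin n)) M] (k : ℕ) : Cardinal :=
  Module.rank ℝ (closedFormsExactAtInfinity n M k ⧸
    (exactForms n M k).submoduleOf (closedFormsExactAtInfinity n M k))

/-- `B` is an open `n`-ball in `M` (with compact closure in `M`): in some smooth chart of `M` it
is a Euclidean open ball whose closed ball is contained in the image of the chart. -/
def IsBall (n : ℕ) {M : Type*} [TopologicalSpace M]
    [ChartedSpace (EuclideanSpace ℝ (Fin n)) M] (B : Set M) : Prop :=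
  ∃ φ ∈ IsManifold.maximalAtlas (𝓡 n) ∞ M, ∃ (p : EuclideanSpace ℝ (Fin n)) (r : ℝ),
    0 < r ∧ Metric.closedBall p r ⊆ φ.target ∧ B = φ.symm '' Metric.ball p r

end DeRham

end

/-! Enlarging the ball puts `K = closure B` inside the domain of a chart onto ℝⁿ; apart from this
only compactness of `K` matters. For `0 < k < n`, restriction of forms induces an isomorphism from
the quotient defining `c_k(M)` onto the one for `M \ K` (`c_opens_eq`). For `k > n` there are no
nonzero forms.

Well defined (`exists_exactOn_compl`): a closed form is exact near `K` by the Poincaré lemma, so a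
compact set outside which it is exact can be replaced by one that misses `K`. Surjective
(`exists_extension`): a form on `M \ K` that is exact off a compact `L` disjoint from `K` equals
`dν` on a punctured neighbourhood of `K`. If `χ` vanishes near `K` and is 1 farther out, `d(χν)`
extends over `K`, and replacing `dν` by it changes the class by `d(χν - ν)`. Injective
(`exactOn_univ_of_exactOn_compl`): if `α = dν` off `K`, then `α - d(χν)` is closed with compact
support in the chart domain, hence exact by the compactly supported Poincaré lemma
(`exists_extDeriv_eq_of_hasCompactSupport`). This needs `k < n`: in degree `n` the integral is an
obstruction.

Both Poincaré lemmas come from the homotopy formula `extDeriv_fiberIntegral`. The compactly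
supported one goes by induction on the degree: integrate along a coordinate direction from either
side, and correct one primitive by a cut-off primitive of the difference of the two. -/

noncomputable section

namespace DeRham

/-! ### Smooth dependence of pullbacks and exterior derivatives -/

section Smoothness

variable {X E F G : Type*} [NormedAddCommGroup X] [NormedSpace ℝ X]
  [NormedAddCommGroup E] [NormedSpace ℝ E] [NormedAddCommGroup F] [NormedSpace ℝ F]
  [NormedAddCommGroup G] [NormedSpace ℝ G]

theorem contDiffAt_clm_of_apply [FiniteDimensional ℝ E] {m : ℕ∞ω} {f : X → E →L[ℝ] G} {x : X}
    (h : ∀ y, ContDiffAt ℝ m (fun x => f x y) x) : ContDiffAt ℝ m f x := by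
  have hd : Module.finrank ℝ E = Module.finrank ℝ (Fin (Module.finrank ℝ E) → ℝ) :=
    (Module.finrank_fin_fun ℝ).symm
  let e₁ := ContinuousLinearEquiv.ofFinrankEq hd
  let e₂ := (e₁.arrowCongr (1 : G ≃L[ℝ] G)).trans
    (ContinuousLinearEquiv.piRing (Fin (Module.finrank ℝ E)))
  rw [← Function.id_comp f, ← e₂.symm_comp_self]
  exact e₂.symm.contDiff.contDiffAt.comp x (contDiffAt_pi.mpr fun i => h _)

/-- The pullback of an alternating form depends smoothly on the form and on the linear map. -/
theorem contDiffAt_compContinuousLinearMap [FiniteDimensional ℝ E] {m : ℕ∞ω} {k : ℕ}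
    {f : X → F [⋀^Fin k]→L[ℝ] ℝ} {A : X → E →L[ℝ] F} {x : X}
    (hf : ContDiffAt ℝ m f x) (hA : ContDiffAt ℝ m A x) :
    ContDiffAt ℝ m (fun x => (f x).compContinuousLinearMap (A x)) x := by
  induction k with
  | zero =>
    have h : (fun x => (f x).compContinuousLinearMap (A x)) = fun x =>
        ContinuousAlternatingMap.constOfIsEmptyLIE ℝ E ℝ (Fin 0)
          (ContinuousAlternatingMap.apply ℝ F ℝ ![] (f x)) := by
      funext x
      ext v
      simp only [ContinuousAlternatingMap.compContinuousLinearMap_apply]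
      exact congrArg (f x) (Subsingleton.elim _ _)
    rw [h]
    exact (ContinuousAlternatingMap.constOfIsEmptyLIE ℝ E ℝ (Fin 0)).contDiff.contDiffAt.comp x
      ((ContinuousAlternatingMap.apply ℝ F ℝ ![]).contDiff.contDiffAt.comp x hf)
  | succ k ih =>
    -- Alternating the currying of a `(k+1)`-form returns `k + 1` times the form. So smoothness
    -- reduces to the contractions with a fixed vector, which are pullbacks of `k`-forms.
    have h : (fun x => (f x).compContinuousLinearMap (A x)) = fun x => ((k + 1 : ℝ)⁻¹) •
        ContinuousAlternatingMap.alternatizeUncurryFinCLM ℝ E ℝ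
          ((f x).compContinuousLinearMap (A x)).curryLeft := by
      funext x
      rw [ContinuousAlternatingMap.alternatizeUncurryFinCLM_apply,
        ContinuousAlternatingMap.alternatizeUncurryFin_curryLeft]
      rw [← Nat.cast_smul_eq_nsmul ℝ, smul_smul]
      push_cast
      rw [inv_mul_cancel₀ (by positivity), one_smul]
    rw [h]
    refine ContDiffAt.const_smul _ ((ContinuousAlternatingMap.alternatizeUncurryFinCLM ℝ E
      ℝ).contDiff.contDiffAt.comp x (contDiffAt_clm_of_apply fun w => ?_))
    simp only [ContinuousAlternatingMap.curryLeft_compContinuousLinearMap]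
    refine ih ?_
    exact ((ContinuousAlternatingMap.curryLeftLI (𝕜 := ℝ) (E := F) (F := ℝ)
      (n := k)).contDiff.contDiffAt.comp x hf).clm_apply (hA.clm_apply contDiffAt_const)

theorem contDiff_alternatizeUncurryFin {k : ℕ} : ContDiff ℝ ∞
    (ContinuousAlternatingMap.alternatizeUncurryFin : (E →L[ℝ] E [⋀^Fin k]→L[ℝ] ℝ) → _) :=
  ContinuousLinearMap.contDiff (𝕜 := ℝ) (E := E →L[ℝ] E [⋀^Fin k]→L[ℝ] ℝ)
    (F := E [⋀^Fin (k + 1)]→L[ℝ] ℝ) (ContinuousAlternatingMap.alternatizeUncurryFinCLM ℝ E ℝ)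

theorem contDiffAt_extDeriv {k : ℕ} {α : E → E [⋀^Fin k]→L[ℝ] ℝ} {x : E}
    (h : ContDiffAt ℝ ∞ α x) : ContDiffAt ℝ ∞ (extDeriv α) x :=
  contDiff_alternatizeUncurryFin.contDiffAt.comp x (h.fderiv_right (m := ∞) (by simp))

theorem contDiff_extDeriv {k : ℕ} {α : E → E [⋀^Fin k]→L[ℝ] ℝ}
    (h : ContDiff ℝ ∞ α) : ContDiff ℝ ∞ (extDeriv α) :=
  contDiff_iff_contDiffAt.2 fun _ => contDiffAt_extDeriv h.contDiffAt

theorem two_le_infty : minSmoothness ℝ 2 ≤ (∞ : ℕ∞ω) := by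
  simp only [minSmoothness_of_isRCLikeNormedField]
  exact WithTop.coe_le_coe.2 (le_top : (2 : ℕ∞) ≤ ⊤)

end Smoothness

/-! ### Smoothness of integrals depending on a parameter -/

section ParametricIntegral

variable {E G : Type*} [NormedAddCommGroup E] [NormedSpace ℝ E] [FiniteDimensional ℝ E]
  [NormedAddCommGroup G] [NormedSpace ℝ G]

theorem hasFDerivAt_integral_of_contDiff {H : ℝ × E → G} (hH : ContDiff ℝ 1 H) (a b : ℝ) (x : E) :
    HasFDerivAt (fun x => ∫ t in a..b, H (t, x))
      (∫ t in a..b, (fderiv ℝ H (t, x)).comp (ContinuousLinearMap.inr ℝ ℝ E)) x := by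
  have hc : Continuous fun p : ℝ × E => (fderiv ℝ H p).comp (ContinuousLinearMap.inr ℝ ℝ E) :=
    (hH.continuous_fderiv (by simp)).clm_comp continuous_const
  -- The derivative in `x` is continuous, hence bounded on the compact product of the interval with
  -- a unit ball; this constant dominates.
  obtain ⟨C, hC⟩ := ((isCompact_uIcc (a := a) (b := b)).prod
    (isCompact_closedBall x 1)).exists_bound_of_continuousOn hc.continuousOn
  refine intervalIntegral.hasFDerivAt_integral_of_dominated_of_fderiv_le
    (F' := fun x t => (fderiv ℝ H (t, x)).comp (ContinuousLinearMap.inr ℝ ℝ E))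
    (bound := fun _ => C) (Metric.closedBall_mem_nhds x one_pos) ?_ ?_ ?_ ?_ ?_ ?_
  · exact Filter.Eventually.of_forall fun y =>
      (hH.continuous.comp (by fun_prop : Continuous fun t : ℝ => (t, y))).aestronglyMeasurable
  · exact (hH.continuous.comp (by fun_prop : Continuous fun t : ℝ => (t, x))).intervalIntegrable _ _
  · exact (hc.comp (by fun_prop : Continuous fun t : ℝ => (t, x))).aestronglyMeasurable
  · exact Filter.Eventually.of_forall fun t ht y hy => hC (t, y) ⟨Set.uIoc_subset_uIcc ht, hy⟩
  · exact intervalIntegrable_const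
  · refine Filter.Eventually.of_forall fun t _ y _ => ?_
    exact ((hH.differentiable (by simp)) (t, y)).hasFDerivAt.comp y (hasFDerivAt_prodMk_right t y)

/-- Each directional derivative of the integral is the integral of another smooth integrand, so
induction on the order of differentiability works once it ranges over all integrands. -/
theorem contDiff_integral {H : ℝ × E → G} (hH : ContDiff ℝ ∞ H) (a b : ℝ) :
    ContDiff ℝ ∞ fun x => ∫ t in a..b, H (t, x) := by
  rw [contDiff_infty]
  intro m
  induction m generalizing H with
  | zero =>
    rw [Nat.cast_zero, contDiff_zero]
    exact continuous_iff_continuousAt.2 fun x =>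
      (hasFDerivAt_integral_of_contDiff (hH.of_le (by exact_mod_cast le_top)) a b x).continuousAt
  | succ m ih =>
    have h1 := hasFDerivAt_integral_of_contDiff (hH.of_le (m := 1) (by exact_mod_cast le_top)) a b
    push_cast
    rw [contDiff_succ_iff_fderiv_apply]
    refine ⟨fun x => (h1 x).differentiableAt, by simp, fun y => ?_⟩
    have h2 : (fun x => fderiv ℝ (fun x => ∫ t in a..b, H (t, x)) x y) =
        fun x => ∫ t in a..b, fderiv ℝ H (t, x) (0, y) := by
      funext x
      rw [(h1 x).fderiv, ContinuousLinearMap.intervalIntegral_apply]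
      · rfl
      · refine Continuous.intervalIntegrable ?_ _ _
        exact ((hH.continuous_fderiv (by simp)).comp (by fun_prop)).clm_comp continuous_const
    rw [h2]
    exact ih (H := fun p => fderiv ℝ H p (0, y))
      ((hH.fderiv_right (m := ∞) (by simp)).clm_apply contDiff_const)

end ParametricIntegral

/-! ### Homotopy formula and the Poincaré lemma -/

section Homotopy

open ContinuousAlternatingMap

variable {E F : Type*} [NormedAddCommGroup E] [NormedSpace ℝ E]
  [NormedAddCommGroup F] [NormedSpace ℝ F]

/-- The contraction with `∂/∂t` of a form on `ℝ × E`, restricted to the slices `{t} × E`. -/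
def contractTime {k : ℕ} (Φ : ℝ × E → (ℝ × E) [⋀^Fin (k + 1)]→L[ℝ] ℝ) (p : ℝ × E) :
    E [⋀^Fin k]→L[ℝ] ℝ :=
  ((Φ p).curryLeft ((1 : ℝ), (0 : E))).compContinuousLinearMap (ContinuousLinearMap.inr ℝ ℝ E)

/-- Integration along the fibres of `ℝ × E → E`, between `a` and `b`. -/
def fiberIntegral {k : ℕ} (a b : ℝ) (Φ : ℝ × E → (ℝ × E) [⋀^Fin (k + 1)]→L[ℝ] ℝ) (x : E) :
    E [⋀^Fin k]→L[ℝ] ℝ :=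
  ∫ t in a..b, contractTime Φ (t, x)

/-- `contractTime` at a point, as a continuous linear map. -/
def contractTimeCLM (E : Type*) [NormedAddCommGroup E] [NormedSpace ℝ E] (k : ℕ) :
    ((ℝ × E) [⋀^Fin (k + 1)]→L[ℝ] ℝ) →L[ℝ] E [⋀^Fin k]→L[ℝ] ℝ :=
  (compContinuousLinearMapCLM (ContinuousLinearMap.inr ℝ ℝ E)).comp
    ((ContinuousLinearMap.apply ℝ _ ((1 : ℝ), (0 : E))).comp
      (curryLeftLI (𝕜 := ℝ) (E := ℝ × E) (F := ℝ) (n := k)).toContinuousLinearMap)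

theorem contDiff_contractTime {k : ℕ} {Φ : ℝ × E → (ℝ × E) [⋀^Fin (k + 1)]→L[ℝ] ℝ}
    (hΦ : ContDiff ℝ ∞ Φ) : ContDiff ℝ ∞ (contractTime Φ) :=
  (contractTimeCLM E k).contDiff.comp hΦ

theorem contDiff_fiberIntegral [FiniteDimensional ℝ E] {k : ℕ}
    {Φ : ℝ × E → (ℝ × E) [⋀^Fin (k + 1)]→L[ℝ] ℝ}
    (hΦ : ContDiff ℝ ∞ Φ) (a b : ℝ) : ContDiff ℝ ∞ (fiberIntegral a b Φ) :=
  contDiff_integral (contDiff_contractTime hΦ) a b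

/-- Cartan's formula at a point, with `D` the derivative of a closed form. Evaluate the vanishing
alternation on `∂/∂t` followed by `v`: omitting `∂/∂t` gives the right side, and the other terms
give minus the left side. -/
theorem alternatizeUncurryFin_contractTime {k : ℕ}
    (D : (ℝ × E) →L[ℝ] (ℝ × E) [⋀^Fin (k + 1)]→L[ℝ] ℝ) (hD : alternatizeUncurryFin D = 0) :
    alternatizeUncurryFin (((contractTimeCLM E k).comp D).comp (ContinuousLinearMap.inr ℝ ℝ E)) =
      (D ((1 : ℝ), (0 : E))).compContinuousLinearMap (ContinuousLinearMap.inr ℝ ℝ E) := by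
  ext v
  have h := congrArg (fun f => f (Matrix.vecCons ((1 : ℝ), (0 : E)) fun i => ((0 : ℝ), v i))) hD
  simp only [alternatizeUncurryFin_apply] at h
  rw [Fin.sum_univ_succ] at h
  simp only [Fin.val_zero, pow_zero, one_smul, Matrix.cons_val_zero, Fin.val_succ,
    Matrix.cons_val_succ] at h
  have e0 : Fin.removeNth 0 (Matrix.vecCons ((1 : ℝ), (0 : E)) fun i => ((0 : ℝ), v i)) =
      fun i => ((0 : ℝ), v i) := by
    funext i; simp [Fin.removeNth]
  have e1 : ∀ i : Fin (k + 1), Fin.removeNth i.succ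
      (Matrix.vecCons ((1 : ℝ), (0 : E)) fun i => ((0 : ℝ), v i)) =
      Matrix.vecCons ((1 : ℝ), (0 : E)) fun j => ((0 : ℝ), i.removeNth v j) := by
    intro i; funext j
    refine Fin.cases ?_ (fun j => ?_) j <;> simp [Fin.removeNth]
  rw [e0] at h
  simp only [e1] at h
  rw [alternatizeUncurryFin_apply]
  have h3 : ∀ i : Fin (k + 1), (-1 : ℤ) ^ (i : ℕ) • ((((contractTimeCLM E k).comp D).comp
      (ContinuousLinearMap.inr ℝ ℝ E)) (v i)) (i.removeNth v) =
      - ((-1 : ℤ) ^ ((i : ℕ) + 1) • (D ((0 : ℝ), v i))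
        (Matrix.vecCons ((1 : ℝ), (0 : E)) fun j => ((0 : ℝ), i.removeNth v j))) := by
    intro i
    rw [pow_succ, mul_neg_one, neg_smul, neg_neg]
    rfl
  rw [Finset.sum_congr rfl fun i _ => h3 i, Finset.sum_neg_distrib]
  exact (eq_neg_of_add_eq_zero_left h).symm

theorem integral_alternatizeUncurryFin {k : ℕ} {f : ℝ → E →L[ℝ] E [⋀^Fin k]→L[ℝ] ℝ}
    (hf : Continuous f) (a b : ℝ) :
    ∫ t in a..b, alternatizeUncurryFin (f t) = alternatizeUncurryFin (∫ t in a..b, f t) :=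
  ContinuousLinearMap.intervalIntegral_comp_comm (𝕜 := ℝ) (E := E →L[ℝ] E [⋀^Fin k]→L[ℝ] ℝ)
    (F := E [⋀^Fin (k + 1)]→L[ℝ] ℝ) (alternatizeUncurryFinCLM ℝ E ℝ)
    (Continuous.intervalIntegrable (μ := MeasureTheory.volume)
      (E := E →L[ℝ] E [⋀^Fin k]→L[ℝ] ℝ) hf a b)

/-- The homotopy formula for closed forms on `ℝ × E`. -/
theorem extDeriv_fiberIntegral [FiniteDimensional ℝ E] {k : ℕ} {Φ : ℝ × E → (ℝ × E) [⋀^Fin (k + 1)]→L[ℝ] ℝ}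
    (hΦ : ContDiff ℝ ∞ Φ) (hd : ∀ p, extDeriv Φ p = 0) (a b : ℝ) (x : E) :
    extDeriv (fiberIntegral a b Φ) x =
      (Φ (b, x)).compContinuousLinearMap (ContinuousLinearMap.inr ℝ ℝ E) -
        (Φ (a, x)).compContinuousLinearMap (ContinuousLinearMap.inr ℝ ℝ E) := by
  have hc := contDiff_contractTime hΦ
  have hdiff : Differentiable ℝ Φ := hΦ.differentiable (by simp)
  have hfd : ∀ p, fderiv ℝ (contractTime Φ) p = (contractTimeCLM E k).comp (fderiv ℝ Φ p) :=
    fun p => ((contractTimeCLM E k).hasFDerivAt.comp p (hdiff p).hasFDerivAt).fderiv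
  have h1 := hasFDerivAt_integral_of_contDiff (hc.of_le (m := 1) (by exact_mod_cast le_top)) a b x
  have hcont : Continuous fun t : ℝ => fderiv ℝ Φ (t, x) :=
    (hΦ.continuous_fderiv (by simp)).comp (by fun_prop)
  rw [extDeriv]
  unfold fiberIntegral
  rw [h1.fderiv, ← integral_alternatizeUncurryFin]
  · simp only [hfd]
    -- The difference of the two ends is the integral of the `t`-derivative of the slices, which
    -- matches the left side pointwise in `t`.
    rw [← intervalIntegral.integral_eq_sub_of_hasDerivAt (a := a) (b := b)
      (f := fun t => (Φ (t, x)).compContinuousLinearMap (ContinuousLinearMap.inr ℝ ℝ E))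
      (f' := fun t => (fderiv ℝ Φ (t, x) ((1 : ℝ), (0 : E))).compContinuousLinearMap
        (ContinuousLinearMap.inr ℝ ℝ E))]
    · exact intervalIntegral.integral_congr fun t _ =>
        alternatizeUncurryFin_contractTime _ (hd (t, x))
    · intro t _
      have h2 : HasDerivAt (fun t : ℝ => (t, x)) ((1 : ℝ), (0 : E)) t :=
        (hasDerivAt_id t).prodMk (hasDerivAt_const t x)
      exact (compContinuousLinearMapCLM (ContinuousLinearMap.inr ℝ ℝ E)).hasFDerivAt.comp_hasDerivAt
        t ((hdiff (t, x)).hasFDerivAt.comp_hasDerivAt t h2)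
    · refine Continuous.intervalIntegrable ?_ _ _
      exact (compContinuousLinearMapCLM (ContinuousLinearMap.inr ℝ ℝ E)).continuous.comp
        (hcont.clm_apply continuous_const)
  · simp only [hfd]
    exact (continuous_const.clm_comp hcont).clm_comp continuous_const

variable [FiniteDimensional ℝ E]

/-- The pullback of a form on a vector space by a map. -/
def pullbackForm {k : ℕ} {E' : Type*} [NormedAddCommGroup E'] [NormedSpace ℝ E'] (f : E' → F)
    (α : F → F [⋀^Fin k]→L[ℝ] ℝ) (p : E') : E' [⋀^Fin k]→L[ℝ] ℝ :=
  (α (f p)).compContinuousLinearMap (fderiv ℝ f p)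

theorem contDiff_pullbackForm {k : ℕ} {f : ℝ × E → F} {α : F → F [⋀^Fin k]→L[ℝ] ℝ}
    (hf : ContDiff ℝ ∞ f) (hα : ContDiff ℝ ∞ α) : ContDiff ℝ ∞ (pullbackForm f α) :=
  contDiff_iff_contDiffAt.2 fun _ => contDiffAt_compContinuousLinearMap
    (hα.comp hf).contDiffAt (hf.fderiv_right (m := ∞) (by simp)).contDiffAt

/-- A homotopy `f` induces a chain homotopy: on closed forms, the pullbacks by the two ends of `f`
differ by the exterior derivative of a fibre integral. -/
theorem extDeriv_fiberIntegral_pullbackForm {k : ℕ} {f : ℝ × E → F}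
    {α : F → F [⋀^Fin (k + 1)]→L[ℝ] ℝ} (hf : ContDiff ℝ ∞ f) (hα : ContDiff ℝ ∞ α)
    (hd : ∀ y, extDeriv α y = 0) (a b : ℝ) (x : E) :
    extDeriv (fiberIntegral a b (pullbackForm f α)) x =
      pullbackForm (fun x => f (b, x)) α x - pullbackForm (fun x => f (a, x)) α x := by
  rw [extDeriv_fiberIntegral (contDiff_pullbackForm hf hα) _ a b x]
  · have h : ∀ t : ℝ, fderiv ℝ (fun x => f (t, x)) x =
        (fderiv ℝ f (t, x)).comp (ContinuousLinearMap.inr ℝ ℝ E) := fun t =>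
      ((hf.differentiable (by simp) (t, x)).hasFDerivAt.comp x
        (hasFDerivAt_prodMk_right t x)).fderiv
    simp only [pullbackForm, h]
    rfl
  · intro p
    unfold pullbackForm
    rw [extDeriv_pullback (hα.differentiable (by simp) _) hf.contDiffAt two_le_infty, hd]
    rfl

/-- The Poincaré lemma on a vector space. -/
theorem exists_extDeriv_eq {k : ℕ} {α : E → E [⋀^Fin (k + 1)]→L[ℝ] ℝ} (hα : ContDiff ℝ ∞ α)
    (hd : ∀ y, extDeriv α y = 0) :
    ∃ η : E → E [⋀^Fin k]→L[ℝ] ℝ, ContDiff ℝ ∞ η ∧ ∀ x, extDeriv η x = α x := by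
  -- Radial contraction: the identity at time 1 and constant at time 0, where the pullback of a form
  -- of positive degree is zero.
  have hf : ContDiff ℝ ∞ fun p : ℝ × E => p.1 • p.2 := contDiff_fst.smul contDiff_snd
  refine ⟨_, contDiff_fiberIntegral (contDiff_pullbackForm hf hα) 0 1, fun x => ?_⟩
  rw [extDeriv_fiberIntegral_pullbackForm hf hα hd]
  simp only [pullbackForm, one_smul, zero_smul, fderiv_fun_id, fderiv_fun_const, Pi.zero_apply]
  have : (α 0).compContinuousLinearMap (0 : E →L[ℝ] E) = 0 := by
    ext v
    exact (α 0).map_coord_zero 0 rfl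
  rw [this, sub_zero]
  rfl

end Homotopy

/-! ### Primitives by integration along parallel lines -/

section LinePrimitive

open ContinuousAlternatingMap

variable {E : Type*} [NormedAddCommGroup E] [NormedSpace ℝ E]

/-- The homotopy that contracts `E` to the hyperplane `m = a` along the lines in direction `e`
(when `m e = 1`). -/
def lineHomotopy (e : E) (m : E →L[ℝ] ℝ) (a : ℝ) (p : ℝ × E) : E :=
  p.2 + ((p.1 - 1) * (m p.2 - a)) • e

theorem contDiff_lineHomotopy (e : E) (m : E →L[ℝ] ℝ) (a : ℝ) :
    ContDiff ℝ ∞ (lineHomotopy e m a) := by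
  unfold lineHomotopy
  fun_prop

/-- The primitive of a closed form given by integration along the lines in direction `e`, starting
from the hyperplane `m = a`. -/
def linePrimitive {k : ℕ} (e : E) (m : E →L[ℝ] ℝ) (a : ℝ)
    (α : E → E [⋀^Fin (k + 1)]→L[ℝ] ℝ) : E → E [⋀^Fin k]→L[ℝ] ℝ :=
  fiberIntegral 0 1 (pullbackForm (lineHomotopy e m a) α)

theorem contDiff_linePrimitive [FiniteDimensional ℝ E] {k : ℕ} (e : E) (m : E →L[ℝ] ℝ) (a : ℝ)
    {α : E → E [⋀^Fin (k + 1)]→L[ℝ] ℝ} (hα : ContDiff ℝ ∞ α) :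
    ContDiff ℝ ∞ (linePrimitive e m a α) :=
  contDiff_fiberIntegral (contDiff_pullbackForm (contDiff_lineHomotopy e m a) hα) 0 1

/-- The homotopy is the identity at time 1 and lands in the hyperplane `m = a` at time 0, where `α`
vanishes, so only the first end survives in the homotopy formula. -/
theorem extDeriv_linePrimitive [FiniteDimensional ℝ E] {k : ℕ} {e : E} {m : E →L[ℝ] ℝ} (hem : m e = 1) {a : ℝ}
    {α : E → E [⋀^Fin (k + 1)]→L[ℝ] ℝ} (hα : ContDiff ℝ ∞ α) (hd : ∀ y, extDeriv α y = 0)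
    (ha : ∀ y, m y = a → α y = 0) (x : E) : extDeriv (linePrimitive e m a α) x = α x := by
  rw [linePrimitive, extDeriv_fiberIntegral_pullbackForm (contDiff_lineHomotopy e m a) hα hd]
  have h1 : (fun x : E => lineHomotopy e m a (1, x)) = fun x => x := by
    funext x; simp [lineHomotopy]
  have h2 : α (lineHomotopy e m a (0, x)) = 0 := ha _ (by simp [lineHomotopy, hem])
  have h3 : pullbackForm (fun x : E => lineHomotopy e m a (0, x)) α x = 0 := by
    rw [pullbackForm, h2]; rfl
  rw [h3, sub_zero, h1, pullbackForm, fderiv_fun_id]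
  rfl

/-- Support control: the primitive at `x` depends on `α` only along the segment swept out by `x`. -/
theorem linePrimitive_eq_zero {k : ℕ} {e : E} {m : E →L[ℝ] ℝ} {a : ℝ}
    {α : E → E [⋀^Fin (k + 1)]→L[ℝ] ℝ} {x : E}
    (h : ∀ t ∈ Set.Icc (0 : ℝ) 1, α (lineHomotopy e m a (t, x)) = 0) :
    linePrimitive e m a α x = 0 := by
  rw [linePrimitive, fiberIntegral,
    intervalIntegral.integral_congr (g := fun _ => (0 : E [⋀^Fin k]→L[ℝ] ℝ))]
  · simp
  · intro t ht
    rw [Set.uIcc_of_le zero_le_one] at ht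
    simp only [contractTime, pullbackForm, h t ht]
    rfl

end LinePrimitive

/-! ### The Poincaré lemma with compact supports -/

section CompactSupport

open ContinuousAlternatingMap

theorem extDeriv_eq_zero_of_eventually {E : Type*} [NormedAddCommGroup E] [NormedSpace ℝ E] {k : ℕ}
    {α : E → E [⋀^Fin k]→L[ℝ] ℝ} {x : E} (h : ∀ᶠ y in 𝓝 x, α y = 0) : extDeriv α x = 0 := by
  have : α =ᶠ[𝓝 x] fun _ => 0 := h
  rw [this.extDeriv_eq, extDeriv, fderiv_fun_const]
  exact map_zero (alternatizeUncurryFinCLM ℝ E ℝ)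

theorem extDeriv_sub {E : Type*} [NormedAddCommGroup E] [NormedSpace ℝ E] {k : ℕ}
    {α β : E → E [⋀^Fin k]→L[ℝ] ℝ} {x : E} (hα : DifferentiableAt ℝ α x)
    (hβ : DifferentiableAt ℝ β x) : extDeriv (α - β) x = extDeriv α x - extDeriv β x := by
  have h : α - β = α + (-1 : ℝ) • β := by
    funext y
    exact (sub_eq_add_neg _ _).trans (congrArg (α y + ·) (neg_one_smul ℝ (β y)).symm)
  rw [h, extDeriv_add hα (hβ.const_smul (-1 : ℝ)), extDeriv_smul, neg_one_smul, sub_eq_add_neg]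

theorem eq_of_extDeriv_eq_zero {E : Type*} [NormedAddCommGroup E] [NormedSpace ℝ E]
    {α : E → E [⋀^Fin 0]→L[ℝ] ℝ} (hα : Differentiable ℝ α) (hd : ∀ x, extDeriv α x = 0) (x y : E) :
    α x = α y := by
  refine is_const_of_fderiv_eq_zero (𝕜 := ℝ) hα (fun z => ?_) x y
  ext w v
  have h := congrArg (fun f => f fun _ => w) (hd z)
  simp only [extDeriv, alternatizeUncurryFin_apply, Fin.sum_univ_succ, Fin.val_zero, pow_zero,
    one_smul, Finset.univ_eq_empty, Finset.sum_empty, add_zero] at h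
  rw [Subsingleton.elim v]
  exact h

variable {n : ℕ}

/-- A closed form with bounded support in the direction of the coordinate `i` has a primitive that
vanishes on the side `c * x i > R`, where `c = ±1`. -/
theorem exists_extDeriv_eq_of_support_coord {T : Finset (Fin n)} {R c : ℝ} (hR : 0 < R)
    (hc : |c| = 1) {i : Fin n} (hi : i ∈ T) {k : ℕ}
    {α : EuclideanSpace ℝ (Fin n) → EuclideanSpace ℝ (Fin n) [⋀^Fin (k + 1)]→L[ℝ] ℝ}
    (hα : ContDiff ℝ ∞ α) (hd : ∀ x, extDeriv α x = 0)
    (hs : ∀ i ∈ T, ∀ x, R < |x i| → α x = 0) :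
    ∃ μ : EuclideanSpace ℝ (Fin n) → EuclideanSpace ℝ (Fin n) [⋀^Fin k]→L[ℝ] ℝ,
      ContDiff ℝ ∞ μ ∧ (∀ x, extDeriv μ x = α x) ∧ (∀ x, R < c * x i → μ x = 0) ∧
        ∀ j ∈ T.erase i, ∀ x, R < |x j| → μ x = 0 := by
  have hcc : c * c = 1 := by rw [← abs_mul_abs_self, hc, one_mul]
  have habs : ∀ z : ℝ, c * z ≤ |z| := fun z => by
    simpa [abs_mul, hc] using le_abs_self (c * z)
  refine ⟨linePrimitive (EuclideanSpace.single i 1) (EuclideanSpace.proj i) (c * (R + 1)) α,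
    contDiff_linePrimitive _ _ _ hα, ?_, fun x hx => ?_, fun j hj x hx => ?_⟩
  -- The starting hyperplane `x i = c * (R + 1)` lies strictly outside the slab that contains the
  -- support.
  · refine extDeriv_linePrimitive (by simp) hα hd fun y hy => hs i hi y ?_
    rw [show y i = c * (R + 1) from hy, abs_mul, hc, one_mul, abs_of_pos (by linarith)]
    linarith
  · refine linePrimitive_eq_zero fun t ht => hs i hi _ ?_
    have h : lineHomotopy (EuclideanSpace.single i 1) (EuclideanSpace.proj i) (c * (R + 1))
        (t, x) i = x i + (t - 1) * (x i - c * (R + 1)) := by simp [lineHomotopy]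
    rw [h]
    refine lt_of_lt_of_le ?_ (habs _)
    -- After multiplication by `c`, the `i`-th coordinate along the segment is a convex combination
    -- of `c * x i` and `R + 1`, both greater than `R`.
    have h2 : c * (x i + (t - 1) * (x i - c * (R + 1))) =
        t * (c * x i) + (1 - t) * (c * c * (R + 1)) := by ring
    rw [h2, hcc]
    rcases ht with ⟨h0, h1⟩
    rcases h0.eq_or_lt with rfl | h0
    · linarith
    · nlinarith
  · have hij : j ≠ i := Finset.ne_of_mem_erase hj
    refine linePrimitive_eq_zero fun t ht => hs j (Finset.mem_of_mem_erase hj) _ ?_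
    have h : lineHomotopy (EuclideanSpace.single i 1) (EuclideanSpace.proj i) (c * (R + 1))
        (t, x) j = x j := by simp [lineHomotopy, hij]
    rwa [h]

/-- A closed form of degree less than `#T` on `ℝⁿ` whose support is bounded in the directions of
the coordinates in `T` has a primitive with the same property. -/
theorem exists_extDeriv_eq_of_support (T : Finset (Fin n)) (R : ℝ) (hR : 0 < R) {k : ℕ}
    (hk : k + 1 < T.card)
    {α : EuclideanSpace ℝ (Fin n) → EuclideanSpace ℝ (Fin n) [⋀^Fin (k + 1)]→L[ℝ] ℝ}
    (hα : ContDiff ℝ ∞ α) (hd : ∀ x, extDeriv α x = 0)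
    (hs : ∀ i ∈ T, ∀ x, R < |x i| → α x = 0) :
    ∃ μ : EuclideanSpace ℝ (Fin n) → EuclideanSpace ℝ (Fin n) [⋀^Fin k]→L[ℝ] ℝ,
      ContDiff ℝ ∞ μ ∧ (∀ x, extDeriv μ x = α x) ∧ ∀ i ∈ T, ∀ x, R < |x i| → μ x = 0 := by
  induction k generalizing T with
  | zero =>
    obtain ⟨i, hi⟩ : T.Nonempty := Finset.card_pos.1 (by omega)
    obtain ⟨μ, hμ, hdμ, hμi, hμj⟩ :=
      exists_extDeriv_eq_of_support_coord hR (c := -1) (by simp) hi hα hd hs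
    obtain ⟨ν, hν, hdν, hνi, hνj⟩ :=
      exists_extDeriv_eq_of_support_coord hR (c := 1) (by simp) hi hα hd hs
    obtain ⟨j, hj⟩ : (T.erase i).Nonempty :=
      Finset.card_pos.1 (by rw [Finset.card_erase_of_mem hi]; omega)
    -- The difference is a closed 0-form, hence constant, and it vanishes where `|x j| > R`. A
    -- second coordinate `j` exists because `T` has at least two elements.
    have hμν : ∀ x, μ x = ν x := by
      intro x
      have h := eq_of_extDeriv_eq_zero (α := μ - ν)
        ((hμ.differentiable (by simp)).sub (hν.differentiable (by simp))) (fun y => by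
          rw [extDeriv_sub (hμ.differentiable (by simp) y) (hν.differentiable (by simp) y),
            hdμ, hdν, sub_self]) x (EuclideanSpace.single j (R + 1))
      have hj' : R < |(EuclideanSpace.single j (R + 1) : EuclideanSpace ℝ (Fin n)) j| := by
        simp only [PiLp.single_apply, if_true]
        rw [abs_of_pos (by linarith)]; linarith
      rw [Pi.sub_apply, Pi.sub_apply, hμj j hj _ hj', hνj j hj _ hj', sub_zero] at h
      exact sub_eq_zero.1 h
    refine ⟨μ, hμ, hdμ, fun l hl x hx => ?_⟩
    by_cases hli : l = i
    · subst hli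
      rcases lt_abs.1 hx with hx | hx
      · rw [hμν, hνi x (by linarith)]
      · exact hμi x (by linarith)
    · exact hμj l (Finset.mem_erase.2 ⟨hli, hl⟩) x hx
  | succ k ih =>
    obtain ⟨i, hi⟩ : T.Nonempty := Finset.card_pos.1 (by omega)
    obtain ⟨μ, hμ, hdμ, hμi, hμj⟩ :=
      exists_extDeriv_eq_of_support_coord hR (c := -1) (by simp) hi hα hd hs
    obtain ⟨ν, hν, hdν, hνi, hνj⟩ :=
      exists_extDeriv_eq_of_support_coord hR (c := 1) (by simp) hi hα hd hs
    have hdμν : ∀ y, extDeriv (μ - ν) y = 0 := fun y => by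
      rw [extDeriv_sub (hμ.differentiable (by simp) y) (hν.differentiable (by simp) y),
        hdμ, hdν, sub_self]
    obtain ⟨γ, hγ, hdγ, hγj⟩ := ih (T.erase i) (by rw [Finset.card_erase_of_mem hi]; omega)
      (hμ.sub hν) hdμν (fun j hj x hx => by
        rw [hμj j hj x hx, hνj j hj x hx, sub_zero])
    -- `χ` is 0 for `x i ≤ 0` and 1 for `x i ≥ R`. Since `dγ = μ - ν`, the primitive `μ - d(χγ)`
    -- equals `ν` where `x i > R` and `μ` where `x i < -R`, so it vanishes on both sides. In the
    -- other directions of `T`, both `μ` and `γ` vanish.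
    set χ : EuclideanSpace ℝ (Fin n) → ℝ := fun x => Real.smoothTransition (x i / R) with hχ
    have hχs : ContDiff ℝ ∞ χ := Real.smoothTransition.contDiff.comp (by fun_prop)
    have hχγ : ContDiff ℝ ∞ fun x => χ x • γ x := hχs.smul hγ
    have hcont : ∀ l : Fin n, Continuous fun y : EuclideanSpace ℝ (Fin n) => y l := fun l => by
      fun_prop
    refine ⟨μ - extDeriv fun x => χ x • γ x, hμ.sub (contDiff_extDeriv hχγ), fun x => ?_,
      fun l hl x hx => ?_⟩
    · rw [extDeriv_sub (hμ.differentiable (by simp) x)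
        ((contDiff_extDeriv hχγ).differentiable (by simp) x),
        extDeriv_extDeriv hχγ two_le_infty, hdμ, Pi.zero_apply, sub_zero]
    · rw [Pi.sub_apply]
      by_cases hli : l = i
      · subst hli
        rcases lt_abs.1 hx with hx | hx
        · have h : (fun x => χ x • γ x) =ᶠ[𝓝 x] γ := by
            filter_upwards [(hcont l).continuousAt.eventually (lt_mem_nhds hx)] with y hy
            rw [hχ]
            simp only
            rw [Real.smoothTransition.one_of_one_le ((one_le_div hR).2 hy.le), one_smul]
          rw [h.extDeriv_eq, hdγ, hνi x (by linarith), sub_zero, sub_self]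
        · rw [hμi x (by linarith), extDeriv_eq_zero_of_eventually, sub_zero]
          have hx0 : x l < 0 := by linarith
          filter_upwards [(hcont l).continuousAt.eventually (gt_mem_nhds hx0)] with y hy
          rw [hχ]
          simp only
          rw [Real.smoothTransition.zero_of_nonpos (div_nonpos_of_nonpos_of_nonneg hy.le hR.le),
            zero_smul]
      · have hl' := Finset.mem_erase.2 ⟨hli, hl⟩
        rw [hμj l hl' x hx, extDeriv_eq_zero_of_eventually, sub_zero]
        filter_upwards [(hcont l).abs.continuousAt.eventually (lt_mem_nhds hx)] with y hy
        rw [hγj l hl' y hy, smul_zero]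

/-- The Poincaré lemma with compact supports, below the top degree. -/
theorem exists_extDeriv_eq_of_hasCompactSupport {k : ℕ} (hk : k + 1 < n)
    {α : EuclideanSpace ℝ (Fin n) → EuclideanSpace ℝ (Fin n) [⋀^Fin (k + 1)]→L[ℝ] ℝ}
    (hα : ContDiff ℝ ∞ α) (hd : ∀ x, extDeriv α x = 0) (hs : HasCompactSupport α) :
    ∃ μ : EuclideanSpace ℝ (Fin n) → EuclideanSpace ℝ (Fin n) [⋀^Fin k]→L[ℝ] ℝ,
      ContDiff ℝ ∞ μ ∧ (∀ x, extDeriv μ x = α x) ∧ HasCompactSupport μ := by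
  obtain ⟨R, hR0, hR⟩ := hs.isCompact.isBounded.exists_pos_norm_le
  obtain ⟨μ, hμ, hdμ, hsμ⟩ := exists_extDeriv_eq_of_support Finset.univ R hR0
    (by rwa [Finset.card_fin]) hα hd (fun i _ x hx => by
      by_contra h
      exact absurd (hR x (subset_tsupport _ h))
        (not_le.2 (hx.trans_le (PiLp.norm_apply_le x i))))
  refine ⟨μ, hμ, hdμ, HasCompactSupport.intro
    (K := EuclideanSpace.equiv (Fin n) ℝ ⁻¹' Set.Icc (fun _ => -R) fun _ => R) ?_ fun x hx => ?_⟩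
  · exact (EuclideanSpace.equiv (Fin n) ℝ).toHomeomorph.isCompact_preimage.2 isCompact_Icc
  · by_contra h
    refine hx ⟨fun i => ?_, fun i => ?_⟩
    · by_contra h'
      exact h (hsμ i (Finset.mem_univ i) x (lt_abs.2 (Or.inr (by
        simp only [EuclideanSpace.equiv] at h'
        have : x i < -R := not_le.1 h'
        linarith))))
    · by_contra h'
      exact h (hsμ i (Finset.mem_univ i) x (lt_abs.2 (Or.inl (not_le.1 h'))))

end CompactSupport

/-- The model space of `n`-manifolds. -/
abbrev Model (n : ℕ) : Type := EuclideanSpace ℝ (Fin n)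

/-! ### Forms in arbitrary charts of the maximal atlas -/

section LocalExpression

variable {n : ℕ} {M : Type*} [TopologicalSpace M] [ChartedSpace (EuclideanSpace ℝ (Fin n)) M]
  {k : ℕ}

/-- The value of a form at a point, as a form on the model space. -/
def Form.val (α : Form n M k) (x : M) : Model n [⋀^Fin k]→L[ℝ] ℝ := α x

/-- The expression of a form in an arbitrary chart. -/
def Form.read (α : Form n M k) (φ : OpenPartialHomeomorph M (Model n)) (y : Model n) :
    Model n [⋀^Fin k]→L[ℝ] ℝ :=
  (α.val (φ.symm y)).compContinuousLinearMap
    (fderiv ℝ (chartAt (Model n) (φ.symm y) ∘ φ.symm) y)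

theorem contDiffAt_transition {φ ψ : OpenPartialHomeomorph M (Model n)}
    (hφ : φ ∈ IsManifold.maximalAtlas (𝓡 n) ∞ M) (hψ : ψ ∈ IsManifold.maximalAtlas (𝓡 n) ∞ M)
    {y : Model n} (hy : y ∈ ψ.target) (hy' : ψ.symm y ∈ φ.source) :
    ContDiffAt ℝ ∞ (φ ∘ ψ.symm) y :=
  ((contMDiffAt_of_mem_maximalAtlas hφ hy').comp y
    (contMDiffAt_symm_of_mem_maximalAtlas hψ hy)).contDiffAt

theorem Form.read_chartAt_self (α : Form n M k) (x : M) :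
    α.read (chartAt (Model n) x) (chartAt (Model n) x x) = α.val x := by
  have hp : (chartAt (Model n) x).symm (chartAt (Model n) x x) = x :=
    (chartAt (Model n) x).left_inv (mem_chart_source _ x)
  have hev : chartAt (Model n) x ∘ (chartAt (Model n) x).symm =ᶠ[𝓝 (chartAt (Model n) x x)] id := by
    filter_upwards [(chartAt (Model n) x).open_target.mem_nhds
      ((chartAt (Model n) x).map_source (mem_chart_source _ x))] with z hz
    exact (chartAt (Model n) x).right_inv hz
  unfold Form.read
  rw [hp, hev.fderiv_eq, fderiv_id]
  rfl

/-- Smoothness of a form at a point. -/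
def Form.SmoothAt (α : Form n M k) (x : M) : Prop :=
  ContDiffAt ℝ ∞ (α.read (chartAt (Model n) x)) (chartAt (Model n) x x)

theorem Form.eventually_read_eq {α β : Form n M k} {φ : OpenPartialHomeomorph M (Model n)} {x : M}
    (hx : x ∈ φ.source) (h : ∀ᶠ y in 𝓝 x, α y = β y) :
    α.read φ =ᶠ[𝓝 (φ x)] β.read φ := by
  have hc : Filter.Tendsto φ.symm (𝓝 (φ x)) (𝓝 x) := by
    simpa [φ.left_inv hx] using (φ.continuousAt_symm (φ.map_source hx)).tendsto
  filter_upwards [hc.eventually h] with y hy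
  unfold Form.read Form.val
  rw [hy]

theorem Form.SmoothAt.congr {α β : Form n M k} {x : M} (hα : α.SmoothAt x)
    (h : ∀ᶠ y in 𝓝 x, α y = β y) : β.SmoothAt x :=
  ContDiffAt.congr_of_eventuallyEq hα
    (Form.eventually_read_eq (mem_chart_source _ x) h).symm

/-- The tangent space at a point is identified with the model space through the preferred chart
there. This is why `Form.read` contains the derivative of `chartAt` composed with `φ.symm`. -/
theorem mfderiv_symm_eq_fderiv {φ : OpenPartialHomeomorph M (Model n)}
    (hφ : φ ∈ IsManifold.maximalAtlas (𝓡 n) ∞ M) {y : Model n} (hy : y ∈ φ.target) :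
    (mfderiv 𝓘(ℝ, Model n) (𝓡 n) φ.symm y : Model n →L[ℝ] Model n) =
      fderiv ℝ (chartAt (Model n) (φ.symm y) ∘ φ.symm) y := by
  have h : MDifferentiableAt 𝓘(ℝ, Model n) (𝓡 n) φ.symm y :=
    (contMDiffAt_symm_of_mem_maximalAtlas hφ hy).mdifferentiableAt (by simp)
  refine h.mfderiv.trans ?_
  simp only [modelWithCornersSelf_coe, Set.range_id, fderivWithin_univ]
  rfl

variable [IsManifold (𝓡 n) ∞ M]

theorem chartAt_mem_maximalAtlas (x : M) :
    chartAt (Model n) x ∈ IsManifold.maximalAtlas (𝓡 n) ∞ M :=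
  IsManifold.chart_mem_maximalAtlas x

theorem Form.inChart_eq_read (α : Form n M k) (x₀ : M) {y : Model n}
    (hy : y ∈ (chartAt (Model n) x₀).target) :
    α.inChart x₀ y = α.read (chartAt (Model n) x₀) y := by
  have h := mfderiv_symm_eq_fderiv (chartAt_mem_maximalAtlas x₀) hy
  unfold Form.inChart Form.read
  rw [← h]
  rfl

/-- The expressions of a form in two charts are related by pullback along the transition map. -/
theorem Form.read_eq_pullbackForm (α : Form n M k) {φ ψ : OpenPartialHomeomorph M (Model n)}
    (hφ : φ ∈ IsManifold.maximalAtlas (𝓡 n) ∞ M) (hψ : ψ ∈ IsManifold.maximalAtlas (𝓡 n) ∞ M)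
    {y : Model n} (hy : y ∈ ψ.target) (hy' : ψ.symm y ∈ φ.source) :
    α.read ψ y = pullbackForm (φ ∘ ψ.symm) (α.read φ) y := by
  have hp : φ.symm (φ (ψ.symm y)) = ψ.symm y := φ.left_inv hy'
  -- Insert `φ.symm ∘ φ`, the identity near the point, so that the chain rule separates the
  -- transition map.
  have hev : chartAt (Model n) (ψ.symm y) ∘ ψ.symm =ᶠ[𝓝 y]
      (chartAt (Model n) (ψ.symm y) ∘ φ.symm) ∘ (φ ∘ ψ.symm) := by
    filter_upwards [(ψ.continuousAt_symm hy).preimage_mem_nhds (φ.open_source.mem_nhds hy')]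
      with z hz
    simp only [Function.comp_apply, φ.left_inv hz]
  have h1 : DifferentiableAt ℝ (φ ∘ ψ.symm) y :=
    (contDiffAt_transition hφ hψ hy hy').differentiableAt (by simp)
  have h2 : DifferentiableAt ℝ (chartAt (Model n) (ψ.symm y) ∘ φ.symm) (φ (ψ.symm y)) :=
    (contDiffAt_transition (chartAt_mem_maximalAtlas _) hφ (φ.map_source hy')
      (by rw [hp]; exact mem_chart_source _ _)).differentiableAt (by simp)
  unfold Form.read pullbackForm
  simp only [Function.comp_apply, hp]
  rw [hev.fderiv_eq, fderiv_comp y (by exact h2) h1]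
  rfl

theorem Form.val_eq_pullbackForm (α : Form n M k) {φ : OpenPartialHomeomorph M (Model n)}
    (hφ : φ ∈ IsManifold.maximalAtlas (𝓡 n) ∞ M) {x : M} (hx : x ∈ φ.source) :
    α.val x = pullbackForm (φ ∘ (chartAt (Model n) x).symm) (α.read φ) (chartAt (Model n) x x) := by
  have hp : (chartAt (Model n) x).symm (chartAt (Model n) x x) = x :=
    (chartAt (Model n) x).left_inv (mem_chart_source _ x)
  rw [← α.read_chartAt_self x, α.read_eq_pullbackForm hφ (chartAt_mem_maximalAtlas x)
    ((chartAt (Model n) x).map_source (mem_chart_source _ x)) (by rwa [hp])]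

/-- Two forms agree at a point if their expressions in some chart do. -/
theorem Form.val_eq_of_read_eq {α β : Form n M k} {φ : OpenPartialHomeomorph M (Model n)}
    (hφ : φ ∈ IsManifold.maximalAtlas (𝓡 n) ∞ M) {x : M} (hx : x ∈ φ.source)
    (h : α.read φ (φ x) = β.read φ (φ x)) : α x = β x := by
  have hp : (chartAt (Model n) x).symm (chartAt (Model n) x x) = x :=
    (chartAt (Model n) x).left_inv (mem_chart_source _ x)
  have h1 := α.val_eq_pullbackForm hφ hx
  have h2 := β.val_eq_pullbackForm hφ hx
  simp only [pullbackForm, Function.comp_apply, hp] at h1 h2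
  rw [h, ← h2] at h1
  exact h1

theorem Form.read_eventuallyEq (α : Form n M k) {φ ψ : OpenPartialHomeomorph M (Model n)}
    (hφ : φ ∈ IsManifold.maximalAtlas (𝓡 n) ∞ M) (hψ : ψ ∈ IsManifold.maximalAtlas (𝓡 n) ∞ M)
    {y : Model n} (hy : y ∈ ψ.target) (hy' : ψ.symm y ∈ φ.source) :
    α.read ψ =ᶠ[𝓝 y] pullbackForm (φ ∘ ψ.symm) (α.read φ) := by
  filter_upwards [ψ.open_target.mem_nhds hy,
    (ψ.continuousAt_symm hy).preimage_mem_nhds (φ.open_source.mem_nhds hy')] with z hz hz'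
  exact α.read_eq_pullbackForm hφ hψ hz hz'

theorem Form.contDiffAt_read_of_contDiffAt_read (α : Form n M k)
    {φ ψ : OpenPartialHomeomorph M (Model n)}
    (hφ : φ ∈ IsManifold.maximalAtlas (𝓡 n) ∞ M) (hψ : ψ ∈ IsManifold.maximalAtlas (𝓡 n) ∞ M)
    {x : M} (hx : x ∈ φ.source) (hx' : x ∈ ψ.source)
    (h : ContDiffAt ℝ ∞ (α.read φ) (φ x)) : ContDiffAt ℝ ∞ (α.read ψ) (ψ x) := by
  have hp : ψ.symm (ψ x) = x := ψ.left_inv hx'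
  have ht := contDiffAt_transition hφ hψ (ψ.map_source hx') (by rwa [hp])
  refine ContDiffAt.congr_of_eventuallyEq ?_
    (α.read_eventuallyEq hφ hψ (ψ.map_source hx') (by rwa [hp]))
  have h' : ContDiffAt ℝ ∞ (α.read φ) ((φ ∘ ψ.symm) (ψ x)) := by
    rwa [Function.comp_apply, hp]
  exact contDiffAt_compContinuousLinearMap (f := α.read φ ∘ φ ∘ ψ.symm) (h'.comp (ψ x) ht)
    (ht.fderiv_right (m := ∞) (by simp))

theorem Form.smoothAt_iff (α : Form n M k) {φ : OpenPartialHomeomorph M (Model n)}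
    (hφ : φ ∈ IsManifold.maximalAtlas (𝓡 n) ∞ M) {x : M} (hx : x ∈ φ.source) :
    α.SmoothAt x ↔ ContDiffAt ℝ ∞ (α.read φ) (φ x) :=
  ⟨α.contDiffAt_read_of_contDiffAt_read (chartAt_mem_maximalAtlas x) hφ (mem_chart_source _ x) hx,
    α.contDiffAt_read_of_contDiffAt_read hφ (chartAt_mem_maximalAtlas x) hx (mem_chart_source _ x)⟩

theorem Form.smoothOn_iff (α : Form n M k) {s : Set M} (hs : IsOpen s) :
    α.SmoothOn s ↔ ∀ x ∈ s, α.SmoothAt x := by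
  constructor
  · intro h x hx
    have hopen : (chartAt (Model n) x).target ∩ (chartAt (Model n) x).symm ⁻¹' s ∈
        𝓝 (chartAt (Model n) x x) := by
      refine Filter.inter_mem ((chartAt (Model n) x).open_target.mem_nhds
        ((chartAt (Model n) x).map_source (mem_chart_source _ x))) ?_
      refine ((chartAt (Model n) x).continuousAt_symm
        ((chartAt (Model n) x).map_source (mem_chart_source _ x))).preimage_mem_nhds ?_
      rw [(chartAt (Model n) x).left_inv (mem_chart_source _ x)]
      exact hs.mem_nhds hx
    have h1 := h x
    simp only [mfld_simps] at h1
    refine (h1.contDiffAt hopen).congr_of_eventuallyEq ?_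
    filter_upwards [hopen] with y hy
    exact (α.inChart_eq_read x hy.1).symm
  · intro h x₀ y hy
    simp only [mfld_simps] at hy
    have h1 := (α.smoothAt_iff (chartAt_mem_maximalAtlas x₀)
      ((chartAt (Model n) x₀).map_target hy.1)).1 (h _ hy.2)
    rw [(chartAt (Model n) x₀).right_inv hy.1] at h1
    refine (h1.congr_of_eventuallyEq ?_).contDiffWithinAt
    filter_upwards [(chartAt (Model n) x₀).open_target.mem_nhds hy.1] with z hz
    exact α.inChart_eq_read x₀ hz

theorem Form.val_d (α : Form n M k) (x : M) :
    α.d.val x = extDeriv (α.read (chartAt (Model n) x)) (chartAt (Model n) x x) := by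
  have hev : α.inChart x =ᶠ[𝓝 (chartAt (Model n) x x)] α.read (chartAt (Model n) x) := by
    filter_upwards [(chartAt (Model n) x).open_target.mem_nhds
      ((chartAt (Model n) x).map_source (mem_chart_source _ x))] with z hz
    exact α.inChart_eq_read x hz
  rw [← hev.extDeriv_eq]
  unfold Form.val Form.d
  rw [mfderiv_extChartAt_self]
  rfl

/-- The exterior derivative can be computed in any chart. -/
theorem Form.read_d (α : Form n M k) {φ : OpenPartialHomeomorph M (Model n)}
    (hφ : φ ∈ IsManifold.maximalAtlas (𝓡 n) ∞ M) {y : Model n} (hy : y ∈ φ.target)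
    (h : α.SmoothAt (φ.symm y)) : α.d.read φ y = extDeriv (α.read φ) y := by
  have hc := chartAt_mem_maximalAtlas (n := n) (φ.symm y)
  have hs : φ.symm y ∈ (chartAt (Model n) (φ.symm y)).source := mem_chart_source _ _
  rw [(α.read_eventuallyEq hc hφ hy hs).extDeriv_eq]
  unfold pullbackForm
  have hd : DifferentiableAt ℝ (α.read (chartAt (Model n) (φ.symm y)))
      ((chartAt (Model n) (φ.symm y) ∘ φ.symm) y) := ContDiffAt.differentiableAt h (by simp)
  -- The exterior derivative on ℝⁿ commutes with pullback along the transition map.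
  rw [extDeriv_pullback hd (contDiffAt_transition hc hφ hy hs) two_le_infty, Form.read, Form.val_d]
  rfl

theorem Form.d_congr {α β : Form n M k} {x : M} (h : ∀ᶠ y in 𝓝 x, α y = β y) :
    α.d x = β.d x := by
  have h1 := α.val_d x
  rw [(Form.eventually_read_eq (mem_chart_source _ x) h).extDeriv_eq, ← β.val_d] at h1
  exact h1

end LocalExpression

/-! ### Transport of forms and of the Poincaré lemmas through a chart -/

section Operations

variable {n : ℕ} {M : Type*} [TopologicalSpace M] [ChartedSpace (EuclideanSpace ℝ (Fin n)) M]
  {k : ℕ}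

theorem Form.smoothAt_zero (x : M) : (0 : Form n M k).SmoothAt x :=
  contDiffAt_const (c := 0)

/-- The product of a form with a function. -/
def Form.fsmul (χ : M → ℝ) (α : Form n M k) : Form n M k := fun x => χ x • α x

/-- The form on `M` that is supported in the domain of the chart `φ`, and is there the pullback of
a form on the model space. -/
def Form.ofModel (φ : OpenPartialHomeomorph M (Model n)) (w : Model n → Model n [⋀^Fin k]→L[ℝ] ℝ) :
    Form n M k := fun x =>
  open Classical in
  if x ∈ φ.source then
    pullbackForm (φ ∘ (chartAt (Model n) x).symm) w (chartAt (Model n) x x)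
  else (0 : Model n [⋀^Fin k]→L[ℝ] ℝ)

theorem Form.ofModel_eq_zero_of_notMem {φ : OpenPartialHomeomorph M (Model n)}
    {w : Model n → Model n [⋀^Fin k]→L[ℝ] ℝ} {x : M} (hx : x ∉ φ.source) :
    Form.ofModel φ w x = 0 := if_neg hx

theorem Form.ofModel_eq_zero {φ : OpenPartialHomeomorph M (Model n)}
    {w : Model n → Model n [⋀^Fin k]→L[ℝ] ℝ} {x : M} (hx : x ∈ φ.source → w (φ x) = 0) :
    Form.ofModel φ w x = 0 := by
  by_cases h : x ∈ φ.source
  · refine (if_pos h).trans ?_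
    rw [pullbackForm, Function.comp_apply, (chartAt (Model n) x).left_inv (mem_chart_source _ x),
      hx h]
    rfl
  · exact Form.ofModel_eq_zero_of_notMem h

variable [IsManifold (𝓡 n) ∞ M]

theorem Form.SmoothAt.fsmul {χ : M → ℝ} {α : Form n M k} {x : M} (hα : α.SmoothAt x)
    (hχ : ContMDiff (𝓡 n) 𝓘(ℝ, ℝ) ∞ χ) : (α.fsmul χ).SmoothAt x := by
  have h1 : ContMDiffAt 𝓘(ℝ, Model n) 𝓘(ℝ, ℝ) ∞ (χ ∘ (chartAt (Model n) x).symm)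
      (chartAt (Model n) x x) :=
    hχ.contMDiffAt.comp _ (contMDiffAt_symm_of_mem_maximalAtlas (chartAt_mem_maximalAtlas x)
      ((chartAt (Model n) x).map_source (mem_chart_source _ x)))
  exact ContDiffAt.smul (f := χ ∘ (chartAt (Model n) x).symm) h1.contDiffAt hα

theorem Form.SmoothAt.d {α : Form n M k} {x : M} (hα : ∀ᶠ y in 𝓝 x, α.SmoothAt y) :
    α.d.SmoothAt x := by
  have hx := mem_chart_source (Model n) x
  have hc : Filter.Tendsto (chartAt (Model n) x).symm (𝓝 (chartAt (Model n) x x)) (𝓝 x) := by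
    simpa [(chartAt (Model n) x).left_inv hx] using
      ((chartAt (Model n) x).continuousAt_symm ((chartAt (Model n) x).map_source hx)).tendsto
  refine (contDiffAt_extDeriv hα.self_of_nhds).congr_of_eventuallyEq ?_
  filter_upwards [hc.eventually hα, (chartAt (Model n) x).open_target.mem_nhds
    ((chartAt (Model n) x).map_source hx)] with y hy hy'
  exact α.read_d (chartAt_mem_maximalAtlas x) hy' hy

theorem Form.d_d {α : Form n M k} {x : M} (hα : ∀ᶠ y in 𝓝 x, α.SmoothAt y) : α.d.d x = 0 := by
  have hx := mem_chart_source (Model n) x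
  have hc : Filter.Tendsto (chartAt (Model n) x).symm (𝓝 (chartAt (Model n) x x)) (𝓝 x) := by
    simpa [(chartAt (Model n) x).left_inv hx] using
      ((chartAt (Model n) x).continuousAt_symm ((chartAt (Model n) x).map_source hx)).tendsto
  have hev : α.d.read (chartAt (Model n) x) =ᶠ[𝓝 (chartAt (Model n) x x)]
      extDeriv (α.read (chartAt (Model n) x)) := by
    filter_upwards [hc.eventually hα, (chartAt (Model n) x).open_target.mem_nhds
      ((chartAt (Model n) x).map_source hx)] with y hy hy'
    exact α.read_d (chartAt_mem_maximalAtlas x) hy' hy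
  have h := α.d.val_d x
  rw [hev.extDeriv_eq, extDeriv_extDeriv_apply hα.self_of_nhds two_le_infty] at h
  exact h

theorem Form.SmoothOn.eventually_smoothAt {α : Form n M k} {s : Set M} (hα : α.SmoothOn s)
    (hs : IsOpen s) {x : M} (hx : x ∈ s) : ∀ᶠ y in 𝓝 x, α.SmoothAt y :=
  Filter.mem_of_superset (hs.mem_nhds hx) ((α.smoothOn_iff hs).1 hα)

theorem Form.SmoothOn.d {α : Form n M k} {s : Set M} (hα : α.SmoothOn s) (hs : IsOpen s) :
    α.d.SmoothOn s :=
  (Form.smoothOn_iff _ hs).2 fun _ hx => Form.SmoothAt.d (hα.eventually_smoothAt hs hx)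

theorem Form.read_ofModel {φ : OpenPartialHomeomorph M (Model n)}
    (hφ : φ ∈ IsManifold.maximalAtlas (𝓡 n) ∞ M) (w : Model n → Model n [⋀^Fin k]→L[ℝ] ℝ)
    {y : Model n} (hy : y ∈ φ.target) : (Form.ofModel φ w).read φ y = w y := by
  have hp : φ.symm y ∈ φ.source := φ.map_target hy
  have hc := mem_chart_source (Model n) (φ.symm y)
  have hcp : (chartAt (Model n) (φ.symm y)).symm (chartAt (Model n) (φ.symm y) (φ.symm y)) =
      φ.symm y := (chartAt (Model n) (φ.symm y)).left_inv hc
  have hval : (Form.ofModel φ w).val (φ.symm y) = pullbackForm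
      (φ ∘ (chartAt (Model n) (φ.symm y)).symm) w (chartAt (Model n) (φ.symm y) (φ.symm y)) :=
    if_pos hp
  have h1 : DifferentiableAt ℝ (chartAt (Model n) (φ.symm y) ∘ φ.symm) y :=
    (contDiffAt_transition (chartAt_mem_maximalAtlas _) hφ hy hc).differentiableAt (by simp)
  have h2 : DifferentiableAt ℝ (φ ∘ (chartAt (Model n) (φ.symm y)).symm)
      ((chartAt (Model n) (φ.symm y) ∘ φ.symm) y) :=
    (contDiffAt_transition hφ (chartAt_mem_maximalAtlas _)
      ((chartAt (Model n) (φ.symm y)).map_source hc) (by rwa [hcp])).differentiableAt (by simp)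
  -- The two transition maps are mutually inverse near `y`, so their derivatives cancel in the
  -- double pullback.
  have hev : (φ ∘ (chartAt (Model n) (φ.symm y)).symm) ∘ (chartAt (Model n) (φ.symm y) ∘ φ.symm)
      =ᶠ[𝓝 y] id := by
    filter_upwards [φ.open_target.mem_nhds hy, (φ.continuousAt_symm hy).preimage_mem_nhds
      ((chartAt (Model n) (φ.symm y)).open_source.mem_nhds hc)] with z hz hz'
    simp only [Function.comp_apply, id]
    rw [(chartAt (Model n) (φ.symm y)).left_inv hz', φ.right_inv hz]
  have h3 := fderiv_comp y h2 h1
  rw [hev.fderiv_eq, fderiv_id] at h3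
  rw [Form.read, hval, pullbackForm, Function.comp_apply, hcp, φ.right_inv hy]
  ext v
  have h4 : ∀ u, fderiv ℝ (φ ∘ (chartAt (Model n) (φ.symm y)).symm)
      (chartAt (Model n) (φ.symm y) (φ.symm y))
      (fderiv ℝ (chartAt (Model n) (φ.symm y) ∘ φ.symm) y u) = u := fun u =>
    (congrArg (fun f => f u) h3).symm
  exact congrArg (w y) (funext fun i => h4 (v i))

theorem Form.smoothAt_ofModel {φ : OpenPartialHomeomorph M (Model n)}
    (hφ : φ ∈ IsManifold.maximalAtlas (𝓡 n) ∞ M) {w : Model n → Model n [⋀^Fin k]→L[ℝ] ℝ}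
    (hw : ContDiff ℝ ∞ w) {x : M} (hx : x ∈ φ.source) : (Form.ofModel φ w).SmoothAt x := by
  rw [Form.smoothAt_iff _ hφ hx]
  refine hw.contDiffAt.congr_of_eventuallyEq ?_
  filter_upwards [φ.open_target.mem_nhds (φ.map_source hx)] with y hy
  exact Form.read_ofModel hφ w hy

theorem Form.d_ofModel {φ : OpenPartialHomeomorph M (Model n)}
    (hφ : φ ∈ IsManifold.maximalAtlas (𝓡 n) ∞ M) {w : Model n → Model n [⋀^Fin k]→L[ℝ] ℝ}
    (hw : ContDiff ℝ ∞ w) {α : Form n M (k + 1)} {x : M} (hx : x ∈ φ.source)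
    (h : extDeriv w (φ x) = α.read φ (φ x)) : (Form.ofModel φ w).d x = α x := by
  refine Form.val_eq_of_read_eq hφ hx ?_
  have hy := φ.map_source hx
  rw [Form.read_d _ hφ hy (Form.smoothAt_ofModel hφ hw (φ.map_target hy)), ← h]
  refine Filter.EventuallyEq.extDeriv_eq ?_
  filter_upwards [φ.open_target.mem_nhds hy] with y hy
  exact Form.read_ofModel hφ w hy

theorem Form.contDiff_read {φ : OpenPartialHomeomorph M (Model n)}
    (hφ : φ ∈ IsManifold.maximalAtlas (𝓡 n) ∞ M) (ht : φ.target = Set.univ) {α : Form n M k}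
    (hα : α.SmoothOn Set.univ) : ContDiff ℝ ∞ (α.read φ) := by
  refine contDiff_iff_contDiffAt.2 fun y => ?_
  have hy : y ∈ φ.target := ht ▸ Set.mem_univ y
  have h := (α.smoothAt_iff hφ (φ.map_target hy)).1
    ((α.smoothOn_iff isOpen_univ).1 hα _ (Set.mem_univ _))
  rwa [φ.right_inv hy] at h

theorem Form.extDeriv_read {φ : OpenPartialHomeomorph M (Model n)}
    (hφ : φ ∈ IsManifold.maximalAtlas (𝓡 n) ∞ M) (ht : φ.target = Set.univ) {α : Form n M k}
    (hα : α.SmoothOn Set.univ) (hd : α.d = 0) (y : Model n) : extDeriv (α.read φ) y = 0 := by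
  rw [← α.read_d hφ (ht ▸ Set.mem_univ y)
    ((α.smoothOn_iff isOpen_univ).1 hα _ (Set.mem_univ _)), hd]
  rfl

/-- A closed form is exact on the domain of a chart onto `ℝⁿ`. -/
theorem Form.exactOn_source {φ : OpenPartialHomeomorph M (Model n)}
    (hφ : φ ∈ IsManifold.maximalAtlas (𝓡 n) ∞ M) (ht : φ.target = Set.univ)
    {α : Form n M (k + 1)} (hα : α.SmoothOn Set.univ) (hd : α.d = 0) : α.ExactOn φ.source := by
  obtain ⟨w, hw, hdw⟩ := exists_extDeriv_eq (Form.contDiff_read hφ ht hα)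
    (Form.extDeriv_read hφ ht hα hd)
  exact ⟨Form.ofModel φ w, (Form.smoothOn_iff _ φ.open_source).2 fun x hx =>
    Form.smoothAt_ofModel hφ hw hx, fun x hx => Form.d_ofModel hφ hw hx (hdw _)⟩

/-- A closed form of degree less than `n` with compact support in the domain of a chart onto `ℝⁿ`
is exact. -/
theorem Form.exactOn_univ_of_support [T2Space M] {φ : OpenPartialHomeomorph M (Model n)}
    (hφ : φ ∈ IsManifold.maximalAtlas (𝓡 n) ∞ M) (ht : φ.target = Set.univ) (hk : k + 1 < n)
    {α : Form n M (k + 1)} (hα : α.SmoothOn Set.univ) (hd : α.d = 0) {C : Set M}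
    (hC : IsCompact C) (hCφ : C ⊆ φ.source) (h0 : ∀ x ∉ C, α x = 0) : α.ExactOn Set.univ := by
  have hs : HasCompactSupport (α.read φ) := by
    refine HasCompactSupport.intro (hC.image_of_continuousOn (φ.continuousOn.mono hCφ)) ?_
    intro y hy
    have h : α.val (φ.symm y) = 0 := h0 _ fun h => hy ⟨_, h, φ.right_inv (ht ▸ Set.mem_univ y)⟩
    rw [Form.read, h]
    rfl
  obtain ⟨w, hw, hdw, hsw⟩ := exists_extDeriv_eq_of_hasCompactSupport hk
    (Form.contDiff_read hφ ht hα) (Form.extDeriv_read hφ ht hα hd) hs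
  -- A compact set is closed in the Hausdorff space `M`; hence the transported primitive vanishes
  -- near every point outside the chart domain, and extension by zero is smooth.
  have hclosed : IsClosed (φ.symm '' tsupport w) :=
    (hsw.isCompact.image_of_continuousOn
      (φ.continuousOn_symm.mono (ht ▸ Set.subset_univ _))).isClosed
  have hzero : ∀ x ∉ φ.source, ∀ᶠ y in 𝓝 x, (0 : Form n M k) y = Form.ofModel φ w y := by
    intro x hx
    have hx' : x ∉ φ.symm '' tsupport w := by
      rintro ⟨y, _, rfl⟩
      exact hx (φ.map_target (ht ▸ Set.mem_univ y))
    filter_upwards [hclosed.isOpen_compl.mem_nhds hx'] with y hy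
    refine (Form.ofModel_eq_zero fun hy' => ?_).symm
    by_contra h
    exact hy ⟨φ y, subset_tsupport _ h, φ.left_inv hy'⟩
  refine ⟨Form.ofModel φ w, (Form.smoothOn_iff _ isOpen_univ).2 fun x _ => ?_, fun x _ => ?_⟩
  · by_cases hx : x ∈ φ.source
    · exact Form.smoothAt_ofModel hφ hw hx
    · exact (Form.smoothAt_zero x).congr (hzero x hx)
  · by_cases hx : x ∈ φ.source
    · exact Form.d_ofModel hφ hw hx (hdw _)
    · rw [← Form.d_congr (hzero x hx), Form.d_zero, h0 x fun h => hx (hCφ h)]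
      rfl

end Operations

/-! ### Gluing, cutoffs and extension of forms across a compact set -/

section Extension

variable {n : ℕ} {M : Type*} [TopologicalSpace M] [ChartedSpace (EuclideanSpace ℝ (Fin n)) M]
  {k : ℕ}

open Classical in
/-- The form equal to `α` on `s` and to `β` elsewhere. -/
def Form.piecewise (s : Set M) (α β : Form n M k) : Form n M k :=
  fun x => if x ∈ s then α x else β x

theorem Form.piecewise_of_mem {s : Set M} {α β : Form n M k} {x : M} (hx : x ∈ s) :
    Form.piecewise s α β x = α x := if_pos hx

theorem Form.piecewise_of_notMem {s : Set M} {α β : Form n M k} {x : M} (hx : x ∉ s) :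
    Form.piecewise s α β x = β x := if_neg hx

theorem Form.d_sub {α η : Form n M k} {s : Set M} (hs : IsOpen s) (hα : α.SmoothOn s)
    (hη : η.SmoothOn s) {x : M} (hx : x ∈ s) : (α - η).d x = α.d x - η.d x := by
  have h : α - η = α + (-1 : ℝ) • η := by rw [neg_one_smul, sub_eq_add_neg]
  rw [h, Form.d_add hs hα (hη.smul _) hx, Form.d_smul, Form.smul_apply]
  exact (congrArg (α.d x + ·) (neg_one_smul ℝ (η.d x))).trans (sub_eq_add_neg _ _).symm

theorem Form.SmoothOn.sub {α η : Form n M k} {s : Set M} (hα : α.SmoothOn s)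
    (hη : η.SmoothOn s) : (α - η).SmoothOn s := by
  have h : α - η = α + (-1 : ℝ) • η := by rw [neg_one_smul, sub_eq_add_neg]
  rw [h]
  exact hα.add (hη.smul _)

theorem Form.ExactOn.congr {α β : Form n M (k + 1)} {s : Set M} (hα : α.ExactOn s)
    (h : ∀ x ∈ s, α x = β x) : β.ExactOn s := by
  obtain ⟨ν, hν, hd⟩ := hα
  exact ⟨ν, hν, fun x hx => (hd x hx).trans (h x hx)⟩

variable [IsManifold (𝓡 n) ∞ M]

theorem Form.SmoothOn.congr {α β : Form n M k} {s : Set M} (hs : IsOpen s) (hα : α.SmoothOn s)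
    (h : ∀ x ∈ s, α x = β x) : β.SmoothOn s :=
  (Form.smoothOn_iff _ hs).2 fun x hx =>
    ((α.smoothOn_iff hs).1 hα x hx).congr (Filter.mem_of_superset (hs.mem_nhds hx) h)

theorem Form.d_eq_of_eqOn {α β : Form n M k} {s : Set M} (hs : IsOpen s)
    (h : ∀ x ∈ s, α x = β x) {x : M} (hx : x ∈ s) : α.d x = β.d x :=
  Form.d_congr (Filter.mem_of_superset (hs.mem_nhds hx) h)

theorem Form.SmoothOn.union {α : Form n M k} {s t : Set M} (hs : IsOpen s) (ht : IsOpen t)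
    (h : α.SmoothOn s) (hαt : α.SmoothOn t) : α.SmoothOn (s ∪ t) :=
  (Form.smoothOn_iff _ (hs.union ht)).2 fun x hx =>
    hx.elim ((α.smoothOn_iff hs).1 h x) ((α.smoothOn_iff ht).1 hαt x)

/-- Exactness on two disjoint open sets gives exactness on their union. -/
theorem Form.ExactOn.union_of_disjoint {α : Form n M (k + 1)} {s t : Set M} (hs : IsOpen s)
    (ht : IsOpen t) (hst : Disjoint s t) (h : α.ExactOn s) (h' : α.ExactOn t) :
    α.ExactOn (s ∪ t) := by
  obtain ⟨ν, hν, hd⟩ := h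
  obtain ⟨μ, hμ, he⟩ := h'
  have h1 : ∀ x ∈ s, ν x = Form.piecewise s ν μ x := fun x hx => (Form.piecewise_of_mem hx).symm
  have h2 : ∀ x ∈ t, μ x = Form.piecewise s ν μ x := fun x hx =>
    (Form.piecewise_of_notMem (Set.disjoint_right.1 hst hx)).symm
  refine ⟨Form.piecewise s ν μ, (hν.congr hs h1).union hs ht (hμ.congr ht h2), ?_⟩
  rintro x (hx | hx)
  · rw [← Form.d_eq_of_eqOn hs h1 hx, hd x hx]
  · rw [← Form.d_eq_of_eqOn ht h2 hx, he x hx]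

/-- A form that is smooth on `W \ K` becomes smooth on `W` after multiplication by a smooth
function vanishing near `K`. -/
theorem Form.SmoothOn.fsmul_of_eventually_eq_zero {ν : Form n M k} {W K : Set M} (hW : IsOpen W)
    (hK : IsClosed K) (hν : ν.SmoothOn (W \ K)) {χ : M → ℝ}
    (hχ : ContMDiff (𝓡 n) 𝓘(ℝ, ℝ) ∞ χ) (h0 : ∀ᶠ x in 𝓝ˢ K, χ x = 0) :
    (ν.fsmul χ).SmoothOn W := by
  refine (Form.smoothOn_iff _ hW).2 fun x hx => ?_
  by_cases hxK : x ∈ K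
  · refine (Form.smoothAt_zero x).congr ?_
    filter_upwards [(eventually_nhdsSet_iff_forall.1 h0) x hxK] with y hy
    change (0 : Form n M k) y = χ y • ν y
    rw [hy, zero_smul]
    rfl
  · exact ((ν.smoothOn_iff (hW.sdiff hK)).1 hν x ⟨hx, hxK⟩).fsmul hχ

/-- Multiplying a primitive defined off `K` by `χ` makes it extend by zero over `K` without changing
it off `C`. -/
theorem exists_cutoff [T2Space M] [SecondCountableTopology M] {K W : Set M} (hK : IsCompact K)
    (hW : IsOpen W) (hKW : K ⊆ W) :
    ∃ (χ : M → ℝ) (C : Set M), ContMDiff (𝓡 n) 𝓘(ℝ, ℝ) ∞ χ ∧ IsCompact C ∧ K ⊆ C ∧ C ⊆ W ∧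
      (∀ᶠ x in 𝓝ˢ K, χ x = 0) ∧ ∀ x ∉ C, χ x = 1 := by
  have : LocallyCompactSpace M := ChartedSpace.locallyCompactSpace (EuclideanSpace ℝ (Fin n)) M
  obtain ⟨C, hC, hKC, hCW⟩ := exists_compact_between hK hW hKW
  obtain ⟨f, h1, h0, -⟩ := exists_contMDiffMap_one_nhds_of_subset_interior (𝓡 n) (n := ⊤)
    hK.isClosed hKC
  refine ⟨fun x => 1 - f x, C, contMDiff_const.sub f.contMDiff, hC,
    hKC.trans interior_subset, hCW, ?_, fun x hx => by simp [h0 x hx]⟩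
  filter_upwards [h1] with x hx
  simp [hx]

variable [T2Space M] {K : Set M}

/-- A closed form on `M` that is exact at infinity is exact on the complement of a compact set
disjoint from a given compact set `K` in the domain of a chart onto `ℝⁿ`. -/
theorem exists_exactOn_compl {φ : OpenPartialHomeomorph M (Model n)}
    (hφ : φ ∈ IsManifold.maximalAtlas (𝓡 n) ∞ M) (ht : φ.target = Set.univ)
    (hK : IsCompact K) (hKφ : K ⊆ φ.source) {α : Form n M (k + 1)}
    (hα : α ∈ closedFormsExactAtInfinity n M (k + 1)) :
    ∃ L : Set M, IsCompact L ∧ Disjoint K L ∧ α.ExactOn Lᶜ := by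
  have : LocallyCompactSpace M := ChartedSpace.locallyCompactSpace (EuclideanSpace ℝ (Fin n)) M
  obtain ⟨⟨hs, hd⟩, L, hL, hex⟩ := hα
  obtain ⟨C, hC, hKC, hCφ⟩ := exists_compact_between hK φ.open_source hKφ
  -- The complement of this set is the disjoint union of the open sets `interior C` and `(L ∪ C)ᶜ`.
  -- Primitives on the two pieces need no matching.
  refine ⟨(L ∪ C) \ interior C, (hL.union hC).diff isOpen_interior,
    Set.disjoint_left.2 fun x hx hx' => hx'.2 (hKC hx), ?_⟩
  have h1 : α.ExactOn (interior C) :=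
    (Form.exactOn_source hφ ht hs hd).mono (interior_subset.trans hCφ)
  have h2 : α.ExactOn (L ∪ C)ᶜ := hex.mono (Set.compl_subset_compl.2 Set.subset_union_left)
  have h3 := h1.union_of_disjoint isOpen_interior (hL.union hC).isClosed.isOpen_compl
    (Set.disjoint_left.2 fun x hx hx' => hx' (Or.inr (interior_subset hx))) h2
  refine h3.mono fun x hx => ?_
  by_cases hxC : x ∈ interior C
  · exact Or.inl hxC
  · exact Or.inr fun h => hx ⟨h, hxC⟩

variable [SecondCountableTopology M]

/-- A closed form of degree less than `n` is exact if it is exact outside a compact set in the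
domain of a chart onto `ℝⁿ`. -/
theorem exactOn_univ_of_exactOn_compl {φ : OpenPartialHomeomorph M (Model n)}
    (hφ : φ ∈ IsManifold.maximalAtlas (𝓡 n) ∞ M) (ht : φ.target = Set.univ) (hk : k + 1 < n)
    (hK : IsCompact K) (hKφ : K ⊆ φ.source) {α : Form n M (k + 1)}
    (hα : α ∈ closedForms n M (k + 1)) (hex : α.ExactOn Kᶜ) : α.ExactOn Set.univ := by
  obtain ⟨hs, hd⟩ := hα
  obtain ⟨ν, hν, hdν⟩ := hex
  obtain ⟨χ, C, hχ, hC, hKC, hCφ, hχ0, hχ1⟩ := exists_cutoff (n := n) hK φ.open_source hKφ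
  have hβ : (ν.fsmul χ).SmoothOn Set.univ := by
    refine Form.SmoothOn.fsmul_of_eventually_eq_zero isOpen_univ hK.isClosed ?_ hχ hχ0
    rwa [← Set.compl_eq_univ_sdiff]
  have hβd := hβ.d isOpen_univ
  -- Off `C` one has `χ = 1` and `dν = α`, so this closed form is supported in `C`, inside the chart
  -- domain.
  have h1 : (α - (ν.fsmul χ).d).ExactOn Set.univ := by
    refine Form.exactOn_univ_of_support hφ ht hk (Form.SmoothOn.sub hs hβd) ?_ hC hCφ
      fun x hx => ?_
    · funext x
      rw [Form.d_sub isOpen_univ hs hβd (Set.mem_univ x), hd,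
        Form.d_d (hβ.eventually_smoothAt isOpen_univ (Set.mem_univ x))]
      exact sub_zero _
    · have h2 : (ν.fsmul χ).d x = ν.d x :=
        Form.d_eq_of_eqOn hC.isClosed.isOpen_compl (fun y hy => by
          change χ y • ν y = ν y
          rw [hχ1 y hy, one_smul]) hx
      change α x - (ν.fsmul χ).d x = 0
      rw [h2, hdν x fun h => hx (hKC h), sub_self]
  have h3 := h1.add isOpen_univ (η := (ν.fsmul χ).d) ⟨_, hβ, fun _ _ => rfl⟩
  rwa [sub_add_cancel] at h3

/-- A closed form on `M \ K` that is exact outside a compact subset of `M \ K` is, up to an exact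
form, the restriction of a closed form on `M` that is exact at infinity. -/
theorem exists_extension (hK : IsCompact K) {α : Form n M (k + 1)} (hs : α.SmoothOn Kᶜ)
    (hd : ∀ x ∈ Kᶜ, α.d x = 0) {L : Set M} (hL : IsCompact L) (hKL : Disjoint K L)
    (hex : α.ExactOn (Lᶜ \ K)) :
    ∃ β ∈ closedFormsExactAtInfinity n M (k + 1), (β - α).ExactOn Kᶜ := by
  have hW : IsOpen Lᶜ := hL.isClosed.isOpen_compl
  have hKc : IsOpen Kᶜ := hK.isClosed.isOpen_compl
  obtain ⟨ν, hν, hdν⟩ := hex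
  obtain ⟨χ, C, hχ, hC, hKC, hCW, hχ0, hχ1⟩ := exists_cutoff (n := n) hK hW hKL.subset_compl_right
  have hCc : IsOpen Cᶜ := hC.isClosed.isOpen_compl
  have hβ : (ν.fsmul χ).SmoothOn Lᶜ :=
    Form.SmoothOn.fsmul_of_eventually_eq_zero hW hK.isClosed hν hχ hχ0
  have hcover : Lᶜ ∪ Cᶜ = Set.univ := Set.eq_univ_of_forall fun x =>
    (Classical.em (x ∈ C)).imp (fun h => hCW h) fun h => h
  have hone : ∀ x ∈ Lᶜ ∩ Cᶜ, (ν.fsmul χ) x = ν x := fun y hy => by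
    change χ y • ν y = ν y
    rw [hχ1 y hy.2, one_smul]
  -- The open sets `Lᶜ` and `Cᶜ` cover `M`, and `β` is `d(χν)` on the first and `α` on the second:
  -- on the overlap `χν = ν` and `dν = α`.
  set β : Form n M (k + 1) := Form.piecewise Lᶜ (ν.fsmul χ).d α with hβdef
  have hβ1 : ∀ x ∈ Lᶜ, (ν.fsmul χ).d x = β x := fun x hx => (Form.piecewise_of_mem hx).symm
  have hβ2 : ∀ x ∈ Cᶜ, α x = β x := fun x hx => by
    by_cases hxL : x ∈ Lᶜ
    · rw [← hβ1 x hxL, Form.d_eq_of_eqOn (hW.inter hCc) hone ⟨hxL, hx⟩,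
        hdν x ⟨hxL, fun h => hx (hKC h)⟩]
    · exact (Form.piecewise_of_notMem hxL).symm
  have hCK : Cᶜ ⊆ Kᶜ := Set.compl_subset_compl.2 hKC
  refine ⟨β, ⟨⟨?_, ?_⟩, L ∪ C, hL.union hC, ?_⟩, ?_⟩
  · change β.SmoothOn Set.univ
    rw [← hcover]
    exact ((hβ.d hW).congr hW hβ1).union hW hCc ((hs.mono hCK).congr hCc hβ2)
  · funext x
    rcases (hcover ▸ Set.mem_univ x : x ∈ Lᶜ ∪ Cᶜ) with hx | hx
    · rw [← Form.d_eq_of_eqOn hW hβ1 hx, Form.d_d (hβ.eventually_smoothAt hW hx)]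
      rfl
    · rw [← Form.d_eq_of_eqOn hCc hβ2 hx, hd x (hCK hx)]
      rfl
  · refine Form.ExactOn.congr (α := α) ⟨ν, hν.mono ?_, fun x hx => hdν x ?_⟩ fun x hx =>
      hβ2 x fun h => hx (Or.inr h)
    · exact fun x hx => ⟨fun h => hx (Or.inl h), fun h => hx (Or.inr (hKC h))⟩
    · exact ⟨fun h => hx (Or.inl h), fun h => hx (Or.inr (hKC h))⟩
  -- A primitive of `β - α` on `Kᶜ`: it is `χν - ν` on `Lᶜ \ K` and zero on `Cᶜ`, consistently
  -- because `χ = 1` off `C`.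
  · set ζ : Form n M k := Form.piecewise Lᶜ (ν.fsmul χ - ν) 0 with hζdef
    have hWK : IsOpen (Lᶜ \ K) := hW.sdiff hK.isClosed
    have hζ1 : ∀ x ∈ Lᶜ \ K, (ν.fsmul χ - ν) x = ζ x := fun x hx =>
      (Form.piecewise_of_mem hx.1).symm
    have hζ2 : ∀ x ∈ Cᶜ, (0 : Form n M k) x = ζ x := fun x hx => by
      by_cases hxL : x ∈ Lᶜ
      · refine Eq.trans ?_ (Form.piecewise_of_mem hxL).symm
        change 0 = (ν.fsmul χ) x - ν x
        rw [hone x ⟨hxL, hx⟩, sub_self]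
      · exact (Form.piecewise_of_notMem hxL).symm
    have hcover' : Kᶜ ⊆ (Lᶜ \ K) ∪ Cᶜ := fun x hx => by
      rcases (hcover ▸ Set.mem_univ x : x ∈ Lᶜ ∪ Cᶜ) with h | h
      · exact Or.inl ⟨h, hx⟩
      · exact Or.inr h
    have hβν := hβ.mono (Set.sdiff_subset (s := Lᶜ) (t := K))
    refine ⟨ζ, Form.SmoothOn.mono ?_ hcover', fun x hx => ?_⟩
    · exact ((hβν.sub hν).congr hWK hζ1).union hWK hCc
        ((Form.SmoothOn.zero _).congr hCc hζ2)
    · rcases hcover' hx with hx | hx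
      · rw [← Form.d_eq_of_eqOn hWK hζ1 hx, Form.d_sub hWK hβν hν hx, hβ1 x hx.1, hdν x hx]
        rfl
      · rw [← Form.d_eq_of_eqOn hCc hζ2 hx, Form.d_zero]
        change 0 = β x - α x
        rw [hβ2 x hx, sub_self]

end Extension

/-! ### Restriction to open submanifolds -/

section Restriction

variable {n : ℕ} {M : Type*} [TopologicalSpace M] [ChartedSpace (EuclideanSpace ℝ (Fin n)) M]
  {k : ℕ} (U : TopologicalSpace.Opens M)

/-- The restriction of a form to an open submanifold. -/
def Form.restrict : Form n M k →ₗ[ℝ] Form n U k where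
  toFun α := fun x => α.val x.1
  map_add' _ _ := rfl
  map_smul' _ _ := rfl

open Classical in
/-- The extension of a form on an open submanifold by zero. -/
def Form.extend (η : Form n U k) : Form n M k :=
  fun x => if h : x ∈ U then η.val ⟨x, h⟩ else (0 : Model n [⋀^Fin k]→L[ℝ] ℝ)

theorem Form.restrict_extend (η : Form n U k) : Form.restrict U (Form.extend U η) = η :=
  funext fun x => dif_pos x.2

variable {U}

theorem Form.read_restrict (α : Form n M k) (φ : OpenPartialHomeomorph M (Model n))
    (hU : Nonempty U) {y : Model n} (hy : y ∈ (φ.subtypeRestr hU).target) :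
    (Form.restrict U α).read (φ.subtypeRestr hU) y = α.read φ y := by
  have hp : ((φ.subtypeRestr hU).symm y : M) = φ.symm y := φ.subtypeRestr_symm_apply hU hy
  have hev : chartAt (Model n) ((φ.subtypeRestr hU).symm y) ∘ (φ.subtypeRestr hU).symm =ᶠ[𝓝 y]
      chartAt (Model n) (φ.symm y) ∘ φ.symm := by
    filter_upwards [(φ.subtypeRestr hU).open_target.mem_nhds hy] with z hz
    have hz' : ((φ.subtypeRestr hU).symm z : M) = φ.symm z := φ.subtypeRestr_symm_apply hU hz
    -- The preferred charts of `U` are restrictions of those of `M`, so both tangent spaces carry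
    -- the same identification with the model space.
    have h : chartAt (Model n) ((φ.subtypeRestr hU).symm y) ((φ.subtypeRestr hU).symm z) =
        chartAt (Model n) ((φ.subtypeRestr hU).symm y : M) ((φ.subtypeRestr hU).symm z : M) := rfl
    rw [Function.comp_apply, h, hz', hp, Function.comp_apply]
  have hv : (Form.restrict U α).val ((φ.subtypeRestr hU).symm y) = α.val (φ.symm y) := by
    rw [← hp]; rfl
  rw [Form.read, Form.read, hev.fderiv_eq, hv]

theorem Form.eventually_read_restrict (α : Form n M k) (x : U) :
    (Form.restrict U α).read (chartAt (Model n) x) =ᶠ[𝓝 (chartAt (Model n) x x)]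
      α.read (chartAt (Model n) x.1) := by
  filter_upwards [(chartAt (Model n) x).open_target.mem_nhds
    ((chartAt (Model n) x).map_source (mem_chart_source _ x))] with y hy
  exact α.read_restrict (chartAt (Model n) x.1) ⟨x⟩ hy

theorem Form.smoothAt_restrict (α : Form n M k) (x : U) :
    (Form.restrict U α).SmoothAt x ↔ α.SmoothAt x.1 :=
  ⟨fun h => ContDiffAt.congr_of_eventuallyEq h (Filter.EventuallyEq.symm
    (α.eventually_read_restrict x)),
    fun h => ContDiffAt.congr_of_eventuallyEq h (α.eventually_read_restrict x)⟩

variable [IsManifold (𝓡 n) ∞ M]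

theorem Form.d_restrict (α : Form n M k) :
    (Form.restrict U α).d = Form.restrict U α.d := by
  funext x
  have h := (Form.restrict U α).val_d x
  rw [(α.eventually_read_restrict x).extDeriv_eq] at h
  exact h.trans (α.val_d x.1).symm

theorem Form.smoothOn_restrict (α : Form n M k) {s : Set M} (hs : IsOpen s) (hsU : s ⊆ U) :
    (Form.restrict U α).SmoothOn (Subtype.val ⁻¹' s) ↔ α.SmoothOn s := by
  rw [Form.smoothOn_iff _ (hs.preimage continuous_subtype_val), Form.smoothOn_iff _ hs]
  exact ⟨fun h x hx => (α.smoothAt_restrict ⟨x, hsU hx⟩).1 (h ⟨x, hsU hx⟩ hx),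
    fun h x hx => (α.smoothAt_restrict x).2 (h x hx)⟩

theorem Form.exactOn_restrict (α : Form n M (k + 1)) {s : Set M} (hs : IsOpen s) (hsU : s ⊆ U) :
    (Form.restrict U α).ExactOn (Subtype.val ⁻¹' s) ↔ α.ExactOn s := by
  constructor
  · rintro ⟨ν, hν, hd⟩
    -- Smoothness and `d` on the open set `s ⊆ U` are local, so the discontinuous extension of `ν`
    -- by zero is still a valid primitive on `s`.
    rw [← Form.restrict_extend U ν] at hν hd
    refine ⟨Form.extend U ν, (Form.smoothOn_restrict _ hs hsU).1 hν, fun x hx => ?_⟩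
    have h := hd ⟨x, hsU hx⟩ hx
    rw [Form.d_restrict] at h
    exact h
  · rintro ⟨ν, hν, hd⟩
    refine ⟨Form.restrict U ν, (Form.smoothOn_restrict _ hs hsU).2 hν, fun x hx => ?_⟩
    rw [Form.d_restrict]
    exact hd x hx

end Restriction

/-! ### The isomorphism induced by restriction -/

section Comparison

theorem preimage_compl_eq_univ {M : Type*} [TopologicalSpace M] {K : Set M}
    {U : TopologicalSpace.Opens M} (hU : (U : Set M) = Kᶜ) :
    (Subtype.val ⁻¹' Kᶜ : Set U) = Set.univ :=
  Set.eq_univ_of_forall fun x => hU ▸ x.2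

variable {n : ℕ} {M : Type*} [TopologicalSpace M] [T2Space M] [SecondCountableTopology M]
  [ChartedSpace (EuclideanSpace ℝ (Fin n)) M] [IsManifold (𝓡 n) ∞ M] {k : ℕ}

/-- Removing a compact set contained in the domain of a chart onto `ℝⁿ` does not change `c_k` for
`0 < k < n`. -/
theorem c_opens_eq {φ : OpenPartialHomeomorph M (Model n)}
    (hφ : φ ∈ IsManifold.maximalAtlas (𝓡 n) ∞ M) (ht : φ.target = Set.univ) (hk : k + 1 < n)
    {K : Set M} (hK : IsCompact K) (hKφ : K ⊆ φ.source) (U : TopologicalSpace.Opens M)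
    (hU : (U : Set M) = Kᶜ) : c n U (k + 1) = c n M (k + 1) := by
  have hKc : IsOpen Kᶜ := hK.isClosed.isOpen_compl
  have huniv := preimage_compl_eq_univ hU
  have hrestr : ∀ α ∈ closedFormsExactAtInfinity n M (k + 1),
      Form.restrict U α ∈ closedFormsExactAtInfinity n U (k + 1) := by
    intro α hα
    obtain ⟨L, hL, hKL, hex⟩ := exists_exactOn_compl hφ ht hK hKφ hα
    refine ⟨⟨?_, ?_⟩, Subtype.val ⁻¹' L, ?_, ?_⟩
    · change (Form.restrict U α).SmoothOn Set.univ
      rw [← huniv, Form.smoothOn_restrict _ hKc hU.ge]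
      exact Form.SmoothOn.mono hα.1.1 (Set.subset_univ _)
    · rw [Form.d_restrict, hα.1.2, map_zero]
    -- Because `L` misses `K`, it lies in `U` and remains compact there.
    · refine Topology.IsInducing.subtypeVal.isCompact_preimage' hL ?_
      rw [Subtype.range_coe]
      exact hU ▸ hKL.subset_compl_left
    · have h := (Form.exactOn_restrict α (hL.isClosed.isOpen_compl.inter hKc)
        (Set.inter_subset_right.trans hU.ge)).2 (hex.mono Set.inter_subset_left)
      rwa [Set.preimage_inter, huniv, Set.inter_univ] at h
  let ρ : closedFormsExactAtInfinity n M (k + 1) →ₗ[ℝ] closedFormsExactAtInfinity n U (k + 1) :=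
    (Form.restrict U).restrict hrestr
  let f := ((exactForms n U (k + 1)).submoduleOf
    (closedFormsExactAtInfinity n U (k + 1))).mkQ ∘ₗ ρ
  have hf : Function.Surjective f := by
    intro q
    obtain ⟨⟨η, ⟨hs, hd⟩, L, hL, hex⟩, rfl⟩ := Submodule.mkQ_surjective _ q
    obtain ⟨α, rfl⟩ : ∃ α, Form.restrict U α = η := ⟨_, Form.restrict_extend U η⟩
    have hsα : α.SmoothOn Kᶜ := by
      rw [← Form.smoothOn_restrict _ hKc hU.ge, huniv]
      exact hs
    have hdα : ∀ x ∈ Kᶜ, α.d x = 0 := fun x hx => by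
      rw [Form.d_restrict] at hd
      exact congrFun hd ⟨x, hU.ge hx⟩
    have hL' : IsCompact (Subtype.val '' L : Set M) := hL.image continuous_subtype_val
    have hKL : Disjoint K (Subtype.val '' L) := by
      refine Set.disjoint_left.2 fun x hx => ?_
      rintro ⟨y, -, rfl⟩
      exact hU.le y.2 hx
    have hLc : Lᶜ = Subtype.val ⁻¹' ((Subtype.val '' L)ᶜ \ K : Set M) := by
      ext y
      simp only [Set.mem_compl_iff, Set.mem_preimage, Set.mem_sdiff,
        Subtype.val_injective.mem_set_image]
      exact ⟨fun h => ⟨h, hU.le y.2⟩, fun h => h.1⟩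
    rw [hLc, Form.exactOn_restrict _ (hL'.isClosed.isOpen_compl.sdiff hK.isClosed)
      (fun x hx => hU.ge hx.2)] at hex
    obtain ⟨β, hβ, hβα⟩ := exists_extension hK hsα hdα hL' hKL hex
    refine ⟨⟨β, hβ⟩, (Submodule.Quotient.eq _).2 ?_⟩
    change (Form.restrict U β - Form.restrict U α).ExactOn Set.univ
    rw [← map_sub, ← huniv, Form.exactOn_restrict _ hKc hU.ge]
    exact hβα
  -- A form in the kernel is exact off `K`; that it is exact on all of `M` is the only point where
  -- `k + 1 < n` enters.
  have hker : LinearMap.ker f = (exactForms n M (k + 1)).submoduleOf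
      (closedFormsExactAtInfinity n M (k + 1)) := by
    ext ⟨α, hα⟩
    have h1 : f ⟨α, hα⟩ = 0 ↔ (Form.restrict U α).ExactOn Set.univ := by
      exact (Submodule.Quotient.mk_eq_zero _)
    rw [LinearMap.mem_ker, h1, ← huniv, Form.exactOn_restrict _ hKc hU.ge]
    exact ⟨fun h => exactOn_univ_of_exactOn_compl hφ ht hk hK hKφ hα.1 h,
      fun h => Form.ExactOn.mono h (Set.subset_univ _)⟩
  have e := LinearMap.quotKerEquivOfSurjective f hf
  rw [hker] at e
  exact e.rank_eq.symm

end Comparison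

/-! ### Charts onto ℝⁿ around closed balls -/

section Ball

variable {n : ℕ} {M : Type*} [TopologicalSpace M] [T2Space M]
  [ChartedSpace (EuclideanSpace ℝ (Fin n)) M]

/-- The closure of a ball in `M` is contained in the domain of a chart onto `ℝⁿ`. -/
theorem IsBall.exists_chart [IsManifold (𝓡 n) ∞ M] {B : Set M} (hB : IsBall n B) :
    ∃ φ ∈ IsManifold.maximalAtlas (𝓡 n) ∞ M, φ.target = Set.univ ∧ closure B ⊆ φ.source := by
  obtain ⟨ψ, hψ, p, r, hr, hsub, rfl⟩ := hB
  -- By compactness a concentric ball of radius `δ + r` still lies in the target of `ψ`. This larger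
  -- open ball is diffeomorphic to ℝⁿ, and composing gives the chart.
  obtain ⟨δ, hδ, hδs⟩ := (isCompact_closedBall p r).exists_thickening_subset_open
    ψ.open_target hsub
  rw [thickening_closedBall hδ hr.le] at hδs
  have hR : 0 < δ + r := by linarith
  set e := OpenPartialHomeomorph.univBall p (δ + r) with he
  have hes : e.source = Set.univ := OpenPartialHomeomorph.univBall_source p (δ + r)
  have het : e.target = Metric.ball p (δ + r) := OpenPartialHomeomorph.univBall_target p hR
  have hes' : ContMDiff 𝓘(ℝ, Model n) 𝓘(ℝ, Model n) ∞ e :=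
    OpenPartialHomeomorph.contDiff_univBall.contMDiff
  have het' : ContMDiffOn 𝓘(ℝ, Model n) 𝓘(ℝ, Model n) ∞ e.symm e.target := by
    rw [het]
    exact OpenPartialHomeomorph.contDiffOn_univBall_symm.contMDiffOn
  refine ⟨ψ.trans e.symm, ?_, ?_, ?_⟩
  · refine OpenPartialHomeomorph.mem_maximalAtlas_of_contMDiffOn _ ?_ ?_
    · refine het'.comp ((contMDiffOn_of_mem_maximalAtlas hψ).mono ?_) ?_
      · exact fun x hx => hx.1
      · exact fun x hx => hx.2
    · refine (contMDiffOn_symm_of_mem_maximalAtlas hψ).comp hes'.contMDiffOn ?_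
      exact fun x hx => hx.2
  · refine Set.eq_univ_of_forall fun y => ⟨?_, ?_⟩
    · change y ∈ e.source
      rw [hes]; trivial
    · change e y ∈ ψ.target
      exact hδs (het ▸ e.map_source (hes ▸ Set.mem_univ y))
  · have hc : IsClosed (ψ.symm '' Metric.closedBall p r) :=
      ((isCompact_closedBall p r).image_of_continuousOn (ψ.continuousOn_symm.mono hsub)).isClosed
    refine (closure_minimal (Set.image_mono Metric.ball_subset_closedBall) hc).trans ?_
    rintro _ ⟨y, hy, rfl⟩
    refine ⟨ψ.map_target (hsub hy), ?_⟩
    change ψ (ψ.symm y) ∈ e.target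
    rw [ψ.right_inv (hsub hy), het]
    exact Metric.closedBall_subset_ball (by linarith) hy

end Ball

/-- There are no nonzero forms of degree greater than `n`. -/
theorem Form.subsingleton_of_lt {n : ℕ} {M : Type*} [TopologicalSpace M]
    [ChartedSpace (EuclideanSpace ℝ (Fin n)) M] {k : ℕ} (hk : n < k) :
    Subsingleton (Form n M k) := by
  have h : ∀ f : Model n [⋀^Fin k]→L[ℝ] ℝ, f = 0 := by
    intro f
    ext v
    refine f.toAlternatingMap.map_linearDependent v fun hv => ?_
    have := hv.fintype_card_le_finrank
    simp only [Fintype.card_fin, finrank_euclideanSpace] at this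
    omega
  exact ⟨fun α β => funext fun x => (h (α.val x)).trans (h (β.val x)).symm⟩

theorem c_eq_zero_of_lt {n : ℕ} {M : Type*} [TopologicalSpace M] [T2Space M]
    [ChartedSpace (EuclideanSpace ℝ (Fin n)) M] {k : ℕ} (hk : n < k) : c n M k = 0 := by
  have := Form.subsingleton_of_lt (M := M) hk
  have : Subsingleton (closedFormsExactAtInfinity n M k ⧸
    (exactForms n M k).submoduleOf (closedFormsExactAtInfinity n M k)) :=
    (Submodule.mkQ_surjective _).subsingleton
  exact rank_subsingleton' ℝ _

end DeRham

end

theorem mainTheorem8 (n : ℕ) (M : Type*) [TopologicalSpace M] [T2Space M]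
    [SecondCountableTopology M] [ChartedSpace (EuclideanSpace ℝ (Fin n)) M]
    [IsManifold (𝓡 n) ∞ M] (k : ℕ) (hk : 0 < k) (hkn : k ≠ n)
    (B : Set M) (hB : DeRham.IsBall n B) (hBc : IsCompact (closure B)) :
    DeRham.c n (⟨(closure B)ᶜ, isClosed_closure.isOpen_compl⟩ : TopologicalSpace.Opens M) k =
      DeRham.c n M k := by
  rcases lt_or_gt_of_ne hkn with h | h
  · obtain ⟨k, rfl⟩ := Nat.exists_eq_add_of_lt hk
    rw [zero_add] at h ⊢
    obtain ⟨φ, hφ, ht, hsub⟩ := hB.exists_chart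
    exact DeRham.c_opens_eq hφ ht h hBc hsub _ rfl
  · rw [DeRham.c_eq_zero_of_lt h, DeRham.c_eq_zero_of_lt h]
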